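/- Let $\mathcal N\subset B(H)$ be a von Neumann algebra on a complex Hilbert space $H$, with a faithful normal semifinite trace $\tau$. For $A\in\mathcal N$ let $\mu(t,A)=\inf\{\|Ap\| : p\in\mathcal N \text{ a projection},\ \tau(1-p)\le t\}$, let $$\mathcal M_{1,\infty}=\Big\{A\in\mathcal N:\ \sup_{t>0}\frac1{\log(1+t)}\int_0^t\mu(s,A)\,ds<\infty\Big\},$$ let $\mathcal M_{1,\infty}^+$ be the set of positive operators in $\mathcal M_{1,\infty}$, and let $\mathcal L_1=\{X\in\mathcal N:\tau(|X|)<\infty\}$, to which $\tau$ is extended linearly. The Cesàro operator is $$(Mx)(t)=\frac1{\log t}\int_1^t x(s)\,\frac{ds}{s},\qquad t\in(0,\infty),\ t\neq1,$$ for functions $x$ on $(0,\infty)$ such that $x(s)/s$ is integrable between $1$ and $t$ for every $t>0$; the value of $Mx$ at the single point $t=1$ is immaterial and is set to $0$. $L_\infty(0,\infty)$ is the space of bounded Lebesgue measurable functions on $(0,\infty)$. Theorem. Let $f:[0,\infty)\to\mathbb C$ be a bounded function of class $C^2$ on $[0,\infty)$ (with one-sided derivatives at $0$) such that $f(0)=f'(0)=0$.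 Let $A\in\mathcal M^+_{1,\infty}$ and $B\in\mathcal N$. Then $f(tA)B\in\mathcal L_1$ for every $t>0$, the function $x(t)=\frac1t\tau(f(tA)B)$ lies in the domain of $M$ described above, and $$Mx=M\Big(t\mapsto\frac1t\tau(f(tA)B)\Big)\in L_\infty(0,\infty).$$ In this sense the generalised heat-kernel functional $\xi_{\omega,B,f}(A)=(\omega\circ M)\big(t\mapsto\frac1t\tau(f(tA)B)\big)$ is well defined for every linear functional $\omega$ on $L_\infty(0,\infty)$, in particular for every generalised limit: the trace is finite, $M$ can be applied to $x$, and $Mx$ lies in the domain of $\omega$. -/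

import Mathlib

open MeasureTheory Set
open scoped ENNReal ComplexStarModule

noncomputable section

/-- A faithful normal semifinite trace on a von Neumann algebra `N ⊆ B(H)`, given by its values
on the positive cone `N⁺ = {x ∈ N | 0 ≤ x}`; values of the function off the cone play no role. -/
structure FNSTrace {H : Type*} [NormedAddCommGroup H] [InnerProductSpace ℂ H] [CompleteSpace H]
    (N : VonNeumannAlgebra H) where
  toFun : (H →L[ℂ] H) → ℝ≥0∞
  add : ∀ x ∈ N, ∀ y ∈ N, 0 ≤ x → 0 ≤ y → toFun (x + y) = toFun x + toFun y
  smul : ∀ (c : ℝ), 0 ≤ c → ∀ x ∈ N, 0 ≤ x → toFun ((c : ℂ) • x) = ENNReal.ofReal c * toFun x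
  tracial : ∀ x ∈ N, toFun (star x * x) = toFun (x * star x)
  faithful : ∀ x ∈ N, 0 ≤ x → toFun x = 0 → x = 0
  normal : ∀ (S : Set (H →L[ℂ] H)) (x : H →L[ℂ] H), (∀ s ∈ S, s ∈ N ∧ 0 ≤ s) → x ∈ N →
    S.Nonempty → DirectedOn (· ≤ ·) S → IsLUB S x → toFun x = ⨆ s ∈ S, toFun s
  semifinite : ∀ x ∈ N, 0 ≤ x → x ≠ 0 → ∃ y ∈ N, 0 ≤ y ∧ y ≠ 0 ∧ y ≤ x ∧ toFun y < ∞

namespace FNSTrace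

variable {H : Type*} [NormedAddCommGroup H] [InnerProductSpace ℂ H] [CompleteSpace H]
  {N : VonNeumannAlgebra H}

/-- The ideal `𝓛₁(N, τ)`: the operators `x ∈ N` with `τ(|x|) < ∞`. -/
def L1 (τ : FNSTrace N) : Set (H →L[ℂ] H) :=
  {x | x ∈ N ∧ τ.toFun (CFC.abs x) < ∞}

/-- The linear extension of `τ` to `𝓛₁(N, τ)`, through the decomposition
`x = (Re x)₊ - (Re x)₋ + i ((Im x)₊ - (Im x)₋)`. It is meaningful for `x ∈ 𝓛₁(N, τ)`. -/
def tr (τ : FNSTrace N) (x : H →L[ℂ] H) : ℂ :=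
  (((τ.toFun ((ℜ x : H →L[ℂ] H)⁺)).toReal - (τ.toFun ((ℜ x : H →L[ℂ] H)⁻)).toReal : ℝ) : ℂ) +
    Complex.I *
      (((τ.toFun ((ℑ x : H →L[ℂ] H)⁺)).toReal - (τ.toFun ((ℑ x : H →L[ℂ] H)⁻)).toReal : ℝ) : ℂ)

/-- The generalised singular value function
`μ(t, A) = inf {‖A p‖ : p a projection in N, τ(1 - p) ≤ t}`. -/
def singularValue (τ : FNSTrace N) (t : ℝ) (A : H →L[ℂ] H) : ℝ :=
  sInf {r : ℝ | ∃ p ∈ N, IsStarProjection p ∧ τ.toFun (1 - p) ≤ ENNReal.ofReal t ∧ r = ‖A * p‖}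

/-- The Marcinkiewicz operator space `𝓜_{1,∞}(N, τ)`: the operators `A ∈ N` with
`sup_{t > 0} (1 / log (1 + t)) ∫₀ᵗ μ(s, A) ds < ∞`. -/
def M1Infty (τ : FNSTrace N) : Set (H →L[ℂ] H) :=
  {A | A ∈ N ∧ BddAbove
    ((fun t : ℝ ↦ (1 / Real.log (1 + t)) * ∫ s in (0 : ℝ)..t, τ.singularValue s A) '' Ioi 0)}

end FNSTrace

/-- `f(A)` for a self-adjoint operator `A` and a complex function `f` of a real variable that is
continuous on the spectrum of `A`, by the continuous functional calculus. -/
def opFun {H : Type*} [NormedAddCommGroup H] [InnerProductSpace ℂ H] [CompleteSpace H]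
    (f : ℝ → ℂ) (A : H →L[ℂ] H) : H →L[ℂ] H :=
  cfc (fun z : ℂ ↦ f z.re) A

/-- `t ↦ (1/t) τ(f(tA)B)`. -/
def heatFun {H : Type*} [NormedAddCommGroup H] [InnerProductSpace ℂ H] [CompleteSpace H]
    {N : VonNeumannAlgebra H} (τ : FNSTrace N) (f : ℝ → ℂ) (A B : H →L[ℂ] H) (t : ℝ) : ℂ :=
  (1 / (t : ℂ)) * τ.tr (opFun f ((t : ℂ) • A) * B)

/-- The functions `x` on `(0,∞)` to which the Cesàro operator applies:
`s ↦ x(s)/s` is integrable between `1` and any `t > 0`. -/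
def CesaroDomain (x : ℝ → ℂ) : Prop :=
  ∀ t : ℝ, 0 < t → IntervalIntegrable (fun s ↦ x s / (s : ℂ)) volume 1 t

/-- The Cesàro operator `(Mx)(t) = (1 / log t) ∫₁ᵗ x(s) ds/s` on functions on `(0,∞)`
(at the single point `t = 1` the quotient is read as `0`). -/
def cesaro (x : ℝ → ℂ) (t : ℝ) : ℂ :=
  (1 / (Real.log t : ℂ)) * ∫ s in (1 : ℝ)..t, x s / (s : ℂ)

/-- `L_∞(0,∞)`: the bounded Lebesgue measurable functions on `(0,∞)`. -/
def LInfty : Set (ℝ → ℂ) :=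
  {x | AEStronglyMeasurable x (volume.restrict (Ioi 0)) ∧ ∃ K : ℝ, ∀ t : ℝ, 0 < t → ‖x t‖ ≤ K}

end

/-!
The trace of a function of `A` is controlled by the singular value function:
`τ(φ(A)) ≤ 4/3 ∫₀^∞ φ(8 μ(u, A)) du` for `φ` continuous and increasing with `φ(0) = 0`. Indeed, if
`‖A p‖` is at most half of a level `l`, the part of `A` above `2l` has trace at most a multiple of
`τ(1 - p)`, and `φ` is recovered from its dyadic level sets by summation by parts. Factoring `f(tA)`
as a product of two operators of Hilbert–Schmidt type absorbs the bounded operator `B`, so that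
`|τ(f(tA)B)|` is at most a constant times `τ(min(1, (tA)²))`. Writing `y = 8 μ(·, A)`, Tonelli's
theorem and `∫₁ᵗ min(s⁻², y²) ds ≤ min(2y, t y²)` reduce the claim to
`∫₀^∞ min(2y, t y²) du = O(log t)`. As `∫₀ᵗ y = O(log t)` and `y` decreases, `y(u) = O(log u / u)`,
and splitting the integral at `u = t²` gives this bound.
-/

namespace FNSTrace

variable {H : Type*} [NormedAddCommGroup H] [InnerProductSpace ℂ H] [CompleteSpace H]
  {N : VonNeumannAlgebra H}

instance smulMemClass : SMulMemClass (VonNeumannAlgebra H) ℂ (H →L[ℂ] H) where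
  smul_mem {N} c _ hx := N.toStarSubalgebra.smul_mem hx c

instance isClosed_coe (N : VonNeumannAlgebra H) : IsClosed (N : Set (H →L[ℂ] H)) := by
  rw [← N.centralizer_centralizer]
  exact Set.isClosed_centralizer _

theorem real_smul_mem (c : ℝ) {x : H →L[ℂ] H} (hx : x ∈ N) : c • x ∈ N := by
  simpa only [Complex.coe_smul] using SMulMemClass.smul_mem (c : ℂ) hx

theorem posPart_mem {x : H →L[ℂ] H} (hx : x ∈ N) : x⁺ ∈ N := cfcₙ_mem (𝕜' := ℂ) _ hx

theorem negPart_mem {x : H →L[ℂ] H} (hx : x ∈ N) : x⁻ ∈ N := cfcₙ_mem (𝕜' := ℂ) _ hx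

theorem cfc_real_mem (φ : ℝ → ℝ) {x : H →L[ℂ] H} (hx : x ∈ N) : cfc φ x ∈ N :=
  cfc_mem (𝕜' := ℂ) φ hx

theorem sqrt_mem {x : H →L[ℂ] H} (hx : x ∈ N) (h0 : 0 ≤ x) : CFC.sqrt x ∈ N := by
  rw [CFC.sqrt_eq_real_sqrt x h0]
  exact cfcₙ_mem (𝕜' := ℂ) _ hx

theorem abs_mem {x : H →L[ℂ] H} (hx : x ∈ N) : CFC.abs x ∈ N :=
  sqrt_mem (mul_mem (star_mem hx) hx) (star_mul_self_nonneg x)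

theorem realPart_mem {x : H →L[ℂ] H} (hx : x ∈ N) : (ℜ x : H →L[ℂ] H) ∈ N := by
  rw [realPart_apply_coe]
  exact real_smul_mem _ (add_mem hx (star_mem hx))

theorem imaginaryPart_mem {x : H →L[ℂ] H} (hx : x ∈ N) : (ℑ x : H →L[ℂ] H) ∈ N := by
  rw [imaginaryPart_apply_coe]
  exact SMulMemClass.smul_mem _ (real_smul_mem _ (sub_mem hx (star_mem hx)))

theorem posPart_eq_cfc (y : H →L[ℂ] H) : y⁺ = cfc (fun x : ℝ ↦ max x 0) y := by
  rw [CFC.posPart_def, cfcₙ_eq_cfc (by fun_prop) (by simp)]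
  rfl

variable (τ : FNSTrace N)

theorem toFun_zero : τ.toFun 0 = 0 := by
  simpa using τ.smul 0 le_rfl 0 (zero_mem N) le_rfl

theorem toFun_real_smul {c : ℝ} (hc : 0 ≤ c) {x : H →L[ℂ] H} (hx : x ∈ N) (h0 : 0 ≤ x) :
    τ.toFun (c • x) = ENNReal.ofReal c * τ.toFun x := by
  rw [← τ.smul c hc x hx h0, Complex.coe_smul]

theorem toFun_mono {x y : H →L[ℂ] H} (hx : x ∈ N) (hy : y ∈ N) (h0 : 0 ≤ x) (h : x ≤ y) :
    τ.toFun x ≤ τ.toFun y := by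
  have hadd := τ.add x hx (y - x) (sub_mem hy hx) h0 (sub_nonneg.2 h)
  rw [add_sub_cancel] at hadd
  exact hadd ▸ le_self_add

theorem toFun_conj_le {z c : H →L[ℂ] H} (hz : z ∈ N) (hc : c ∈ N) (h0 : 0 ≤ z) :
    τ.toFun (star c * z * c) ≤ ENNReal.ofReal (‖c‖ ^ 2) * τ.toFun z := by
  set w := CFC.sqrt z
  have hwN : w ∈ N := sqrt_mem hz h0
  have hw_star : star w = w := (CFC.sqrt_nonneg z).isSelfAdjoint
  have hww : w * w = z := CFC.sqrt_mul_sqrt_self z h0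
  have hwc : star (w * c) * (w * c) = star c * z * c := by
    rw [star_mul, hw_star, ← hww]
    simp only [mul_assoc]
  rw [← hwc, τ.tracial _ (mul_mem hwN hc), ← τ.toFun_real_smul (by positivity) hz h0]
  refine τ.toFun_mono (mul_mem (mul_mem hwN hc) (star_mem (mul_mem hwN hc)))
    (real_smul_mem _ hz) (mul_star_self_nonneg _) ?_
  calc w * c * star (w * c) = star w * (c * star c) * w := by
        rw [star_mul, hw_star]
        simp only [mul_assoc]
    _ ≤ star w * algebraMap ℝ _ (‖c‖ ^ 2) * w :=
        star_left_conjugate_le_conjugate CStarAlgebra.mul_star_le_algebraMap_norm_sq w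
    _ = ‖c‖ ^ 2 • z := by
        rw [hw_star, Algebra.algebraMap_eq_smul_one, mul_smul_comm, mul_one, smul_mul_assoc, hww]

theorem toFun_conj_le_of_norm_le_one {z c : H →L[ℂ] H} (hz : z ∈ N) (hc : c ∈ N) (h0 : 0 ≤ z)
    (h1 : ‖c‖ ≤ 1) : τ.toFun (star c * z * c) ≤ τ.toFun z := by
  refine (τ.toFun_conj_le hz hc h0).trans (mul_le_of_le_one_left zero_le ?_)
  exact ENNReal.ofReal_le_one.2 (pow_le_one₀ (norm_nonneg _) h1)

theorem toFun_cfc_mono {A : H →L[ℂ] H} (hA : A ∈ N) {φ ψ : ℝ → ℝ}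
    (hφ : ContinuousOn φ (spectrum ℝ A)) (hψ : ContinuousOn ψ (spectrum ℝ A))
    (h0 : ∀ x ∈ spectrum ℝ A, 0 ≤ φ x) (h : ∀ x ∈ spectrum ℝ A, φ x ≤ ψ x) :
    τ.toFun (cfc φ A) ≤ τ.toFun (cfc ψ A) :=
  τ.toFun_mono (cfc_real_mem φ hA) (cfc_real_mem ψ hA) (cfc_nonneg h0) (cfc_mono h hφ hψ)

theorem toFun_cfc_add {A : H →L[ℂ] H} (hA : A ∈ N) {φ ψ : ℝ → ℝ}
    (hφ : ContinuousOn φ (spectrum ℝ A)) (hψ : ContinuousOn ψ (spectrum ℝ A))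
    (hφ0 : ∀ x ∈ spectrum ℝ A, 0 ≤ φ x) (hψ0 : ∀ x ∈ spectrum ℝ A, 0 ≤ ψ x) :
    τ.toFun (cfc (fun x ↦ φ x + ψ x) A) = τ.toFun (cfc φ A) + τ.toFun (cfc ψ A) := by
  rw [cfc_add (a := A) φ ψ hφ hψ]
  exact τ.add _ (cfc_real_mem φ hA) _ (cfc_real_mem ψ hA) (cfc_nonneg hφ0) (cfc_nonneg hψ0)

theorem toFun_cfc_const_mul {A : H →L[ℂ] H} (hA : A ∈ N) {c : ℝ} (hc : 0 ≤ c) {φ : ℝ → ℝ}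
    (hφ : ContinuousOn φ (spectrum ℝ A)) (h0 : ∀ x ∈ spectrum ℝ A, 0 ≤ φ x) :
    τ.toFun (cfc (fun x ↦ c * φ x) A) = ENNReal.ofReal c * τ.toFun (cfc φ A) := by
  rw [cfc_const_mul c φ A hφ, τ.toFun_real_smul hc (cfc_real_mem φ hA) (cfc_nonneg h0)]

theorem toFun_cfc_sum {ι : Type*} (s : Finset ι) {A : H →L[ℂ] H} (hA : A ∈ N) {φ : ι → ℝ → ℝ}
    (hφ : ∀ i, ContinuousOn (φ i) (spectrum ℝ A)) (h0 : ∀ i, ∀ x ∈ spectrum ℝ A, 0 ≤ φ i x) :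
    τ.toFun (cfc (fun x ↦ ∑ i ∈ s, φ i x) A) = ∑ i ∈ s, τ.toFun (cfc (φ i) A) := by
  classical
  induction s using Finset.induction_on with
  | empty => simpa using τ.toFun_zero
  | insert i s hi ih =>
    simp only [Finset.sum_insert hi]
    rw [τ.toFun_cfc_add hA (hφ i) (continuousOn_finsetSum s fun j _ ↦ hφ j) (h0 i)
      (fun x hx ↦ Finset.sum_nonneg fun j _ ↦ h0 j x hx), ih]

theorem isLUB_cfc_max_sub {A : H →L[ℂ] H} (hA : IsSelfAdjoint A) {φ : ℝ → ℝ}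
    (hφ : ContinuousOn φ (spectrum ℝ A)) (h0 : ∀ x ∈ spectrum ℝ A, 0 ≤ φ x) :
    IsLUB ((fun ε : ℝ ↦ cfc (fun x ↦ max (φ x - ε) 0) A) '' Ioi 0) (cfc φ A) := by
  constructor
  · rintro _ ⟨ε, hε, rfl⟩
    exact cfc_mono fun x hx ↦ max_le (sub_le_self _ (le_of_lt hε)) (h0 x hx)
  · intro u hu
    have hle : ∀ ε ∈ Ioi (0 : ℝ), cfc φ A ≤ u + algebraMap ℝ _ ε := by
      intro ε hε
      rw [← sub_le_iff_le_add, ← cfc_const ε A, ← cfc_sub φ (fun _ ↦ ε) A]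
      exact (cfc_mono fun x _ ↦ le_max_left _ _).trans (hu ⟨ε, hε, rfl⟩)
    have hlim : Filter.Tendsto (fun ε : ℝ ↦ u + algebraMap ℝ (H →L[ℂ] H) ε)
        (nhdsWithin 0 (Ioi 0)) (nhds u) := by
      have h := (continuous_const.add (continuous_algebraMap ℝ (H →L[ℂ] H))).tendsto' (0 : ℝ)
        (u + algebraMap ℝ _ 0) rfl
      rw [map_zero, add_zero] at h
      exact h.mono_left nhdsWithin_le_nhds
    exact ge_of_tendsto hlim (Filter.eventually_of_mem self_mem_nhdsWithin hle)

theorem toFun_cfc_le_of_forall_pos {A : H →L[ℂ] H} (hA : A ∈ N) (hsa : IsSelfAdjoint A)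
    {φ : ℝ → ℝ} (hφ : ContinuousOn φ (spectrum ℝ A)) (h0 : ∀ x ∈ spectrum ℝ A, 0 ≤ φ x) {c : ℝ≥0∞}
    (h : ∀ ε : ℝ, 0 < ε → τ.toFun (cfc (fun x ↦ max (φ x - ε) 0) A) ≤ c) :
    τ.toFun (cfc φ A) ≤ c := by
  rw [τ.normal ((fun ε : ℝ ↦ cfc (fun x ↦ max (φ x - ε) 0) A) '' Ioi 0) (cfc φ A) ?_
    (cfc_real_mem φ hA) ⟨_, 1, mem_Ioi.2 one_pos, rfl⟩ ?_ (isLUB_cfc_max_sub hsa hφ h0)]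
  · simpa only [mem_image, mem_Ioi, iSup_exists, iSup_and, iSup_le_iff, forall_apply_eq_imp_iff₂,
      forall_exists_index, and_imp] using h
  · rintro _ ⟨ε, -, rfl⟩
    exact ⟨cfc_real_mem _ hA, cfc_nonneg fun _ _ ↦ le_max_right _ _⟩
  · rintro _ ⟨a, ha, rfl⟩ _ ⟨b, hb, rfl⟩
    refine ⟨_, ⟨min a b, mem_Ioi.2 (lt_min ha hb), rfl⟩, cfc_mono fun x _ ↦ ?_,
      cfc_mono fun x _ ↦ ?_⟩
    · exact max_le_max_right _ (sub_le_sub_left (min_le_left a b) _)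
    · exact max_le_max_right _ (sub_le_sub_left (min_le_right a b) _)

theorem star_cfc_mul_mul_cfc {y : H →L[ℂ] H} (hy : IsSelfAdjoint y) {g : ℝ → ℝ}
    (hg : ContinuousOn g (spectrum ℝ y)) :
    star (cfc g y) * y * cfc g y = cfc (fun t ↦ g t * t * g t) y := by
  have hG_star : star (cfc g y) = cfc g y := IsSelfAdjoint.cfc
  rw [hG_star, cfc_mul (fun t ↦ g t * t) g y (hg.mul continuousOn_id) hg,
    cfc_mul g (fun t ↦ t) y hg continuousOn_id, cfc_id' ℝ y hy]

/- With `g = t⁺ / (t⁺ + ε / 2)` one has `(t⁺ - ε)⁺ ≤ g * t * g`, so that `(y⁺ - ε)⁺` is dominated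
by `g(y) * y * g(y) ≤ g(y) * z * g(y)`, where `g(y)` is a contraction. -/
theorem toFun_posPart_le {y z : H →L[ℂ] H} (hy : y ∈ N) (hz : z ∈ N) (h0 : 0 ≤ z) (h : y ≤ z) :
    τ.toFun y⁺ ≤ τ.toFun z := by
  have hsa : IsSelfAdjoint y := by
    simpa only [sub_sub_cancel] using h0.isSelfAdjoint.sub (sub_nonneg.2 h).isSelfAdjoint
  rw [posPart_eq_cfc]
  refine τ.toFun_cfc_le_of_forall_pos hy hsa (by fun_prop) (fun _ _ ↦ le_max_right _ _)
    fun ε hε ↦ ?_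
  set g : ℝ → ℝ := fun t ↦ max t 0 / (max t 0 + ε / 2)
  have hpos : ∀ t : ℝ, 0 < max t 0 + ε / 2 := fun t ↦ by
    linarith [le_max_right t 0]
  have hg : Continuous g := Continuous.div (by fun_prop) (by fun_prop) fun t ↦ (hpos t).ne'
  have hg0 : ∀ t, 0 ≤ g t := fun t ↦ div_nonneg (le_max_right _ _) (hpos t).le
  have hg1 : ∀ t, g t ≤ 1 := fun t ↦ (div_le_one (hpos t)).2 (by linarith)
  have hle : ∀ t, max (max t 0 - ε) 0 ≤ g t * t * g t := by
    intro t
    rcases le_total t 0 with ht | ht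
    · simp [g, max_eq_right ht, hε.le]
    · have ht' := hpos t
      simp only [g, max_eq_left ht] at ht' ⊢
      refine max_le ?_ (by positivity)
      rw [div_mul_eq_mul_div, div_mul_div_comm, le_div_iff₀ (by positivity)]
      nlinarith [mul_nonneg ht (sq_nonneg ε), pow_pos hε 3]
  have hG : cfc g y ∈ N := cfc_real_mem g hy
  have hG_norm : ‖cfc g y‖ ≤ 1 := norm_cfc_le zero_le_one fun t _ ↦ by
    rw [Real.norm_of_nonneg (hg0 t)]
    exact hg1 t
  calc τ.toFun (cfc (fun t ↦ max (max t 0 - ε) 0) y)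
      ≤ τ.toFun (star (cfc g y) * z * cfc g y) := by
        refine τ.toFun_mono (cfc_real_mem _ hy) (mul_mem (mul_mem (star_mem hG) hz) hG)
          (cfc_nonneg fun _ _ ↦ le_max_right _ _) ?_
        refine le_trans ?_ (star_left_conjugate_le_conjugate h _)
        rw [star_cfc_mul_mul_cfc hsa hg.continuousOn]
        exact cfc_mono (fun t _ ↦ hle t) (by fun_prop)
          ((hg.mul continuous_id).mul hg).continuousOn
    _ ≤ τ.toFun z := τ.toFun_conj_le_of_norm_le_one hz hG h0 hG_norm

theorem exists_star_mul_eq_cfc_abs {y : H →L[ℂ] H} (hy : y ∈ N) {ε : ℝ} (hε : 0 < ε) :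
    ∃ v ∈ N, ‖v‖ ≤ 1 ∧ star v * y = cfc (fun t : ℝ ↦ t ^ 2 / (t + ε)) (CFC.abs y) := by
  set a := CFC.abs y
  have ha : ∀ t ∈ spectrum ℝ a, 0 ≤ t := fun t ht ↦
    spectrum_nonneg_of_nonneg (CFC.abs_nonneg y) ht
  set g : ℝ → ℝ := fun t ↦ 1 / (t + ε)
  have hg : ContinuousOn g (spectrum ℝ a) := by
    refine ContinuousOn.div (by fun_prop) (by fun_prop) fun t ht ↦ ?_
    linarith [ha t ht]
  have hgN : cfc g a ∈ N := cfc_real_mem g (abs_mem hy)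
  have hvy : star (y * cfc g a) * y = cfc (fun t ↦ g t * t ^ 2) a := by
    have hG_star : star (cfc g a) = cfc g a := IsSelfAdjoint.cfc
    rw [star_mul, hG_star, mul_assoc, ← CFC.abs_mul_abs y, ← pow_two,
      cfc_mul g (fun t ↦ t ^ 2) a, cfc_pow_id a 2]
  have hvv : star (y * cfc g a) * (y * cfc g a) = cfc (fun t ↦ g t * t ^ 2 * g t) a := by
    rw [cfc_mul (fun t ↦ g t * t ^ 2) g a, ← hvy, mul_assoc]
  refine ⟨y * cfc g a, mul_mem hy hgN, ?_, ?_⟩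
  · have hsq : ‖star (y * cfc g a) * (y * cfc g a)‖ ≤ 1 := by
      rw [hvv]
      refine norm_cfc_le zero_le_one fun t ht ↦ ?_
      have ht0 := ha t ht
      rw [Real.norm_of_nonneg (by positivity)]
      simp only [g]
      rw [div_mul_eq_mul_div, div_mul_div_comm, div_le_one (by positivity)]
      nlinarith
    rw [CStarRing.norm_star_mul_self] at hsq
    nlinarith [norm_nonneg (y * cfc g a)]
  · rw [hvy]
    simp only [g, one_div_mul_eq_div]

theorem add_self_le_conj_add {v p q : H →L[ℂ] H} (h : IsSelfAdjoint (star v * (star p * q))) :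
    star v * (star p * q) + star v * (star p * q) ≤
      star v * (star p * p) * v + star q * q := by
  have hsq := star_mul_self_nonneg (p * v - q)
  have hexpand : star (p * v - q) * (p * v - q) = star v * (star p * p) * v + star q * q -
      (star v * (star p * q) + star (star v * (star p * q))) := by
    simp only [star_sub, star_mul, star_star, sub_mul, mul_sub, mul_assoc]
    abel
  rw [hexpand, h.star_eq] at hsq
  exact sub_nonneg.1 hsq

theorem two_mul_toFun_abs_star_mul_le {p q : H →L[ℂ] H} (hp : p ∈ N) (hq : q ∈ N) :
    2 * τ.toFun (CFC.abs (star p * q)) ≤ τ.toFun (star p * p) + τ.toFun (star q * q) := by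
  set a := CFC.abs (star p * q)
  have haN : a ∈ N := abs_mem (mul_mem (star_mem hp) hq)
  have ha0 : ∀ t ∈ spectrum ℝ a, 0 ≤ t := fun t ht ↦
    spectrum_nonneg_of_nonneg (CFC.abs_nonneg _) ht
  suffices h : τ.toFun (cfc (fun t : ℝ ↦ 2 * t) a) ≤
      τ.toFun (star p * p) + τ.toFun (star q * q) by
    rwa [τ.toFun_cfc_const_mul haN zero_le_two (by fun_prop) ha0, cfc_id' ℝ a,
      ENNReal.ofReal_ofNat] at h
  refine τ.toFun_cfc_le_of_forall_pos haN (CFC.abs_nonneg _).isSelfAdjoint (by fun_prop)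
    (fun t ht ↦ mul_nonneg zero_le_two (ha0 t ht)) fun ε hε ↦ ?_
  obtain ⟨v, hv, hv1, hvpq⟩ := exists_star_mul_eq_cfc_abs (mul_mem (star_mem hp) hq) (half_pos hε)
  have hcont : ContinuousOn (fun t : ℝ ↦ t ^ 2 / (t + ε / 2)) (spectrum ℝ a) := by
    refine ContinuousOn.div (by fun_prop) (by fun_prop) fun t ht ↦ ?_
    linarith [ha0 t ht]
  have hcut : cfc (fun t : ℝ ↦ max (2 * t - ε) 0) a ≤
      star v * (star p * q) + star v * (star p * q) := by
    rw [hvpq, ← cfc_add (a := a) _ _ hcont hcont]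
    refine cfc_mono (fun t ht ↦ ?_) (by fun_prop) (hcont.add hcont)
    have ht0 := ha0 t ht
    refine max_le ?_ (by positivity)
    rw [← add_div, le_div_iff₀ (by positivity)]
    nlinarith [sq_nonneg ε]
  have hsa : IsSelfAdjoint (star v * (star p * q)) := by
    rw [hvpq]
    exact IsSelfAdjoint.cfc
  have hpp : star p * p ∈ N := mul_mem (star_mem hp) hp
  have hqq : star q * q ∈ N := mul_mem (star_mem hq) hq
  have hvpN : star v * (star p * p) * v ∈ N := mul_mem (mul_mem (star_mem hv) hpp) hv
  refine (τ.toFun_mono (cfc_real_mem _ haN) (add_mem hvpN hqq)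
    (cfc_nonneg fun _ _ ↦ le_max_right _ _) (hcut.trans (add_self_le_conj_add hsa))).trans ?_
  rw [τ.add _ hvpN _ hqq (star_left_conjugate_nonneg (star_mul_self_nonneg p) v)
    (star_mul_self_nonneg q)]
  gcongr
  exact τ.toFun_conj_le_of_norm_le_one hpp hv (star_mul_self_nonneg p) hv1

theorem toFun_negPart_le {y z : H →L[ℂ] H} (hy : y ∈ N) (hz : z ∈ N) (h0 : 0 ≤ z) (h : -z ≤ y) :
    τ.toFun y⁻ ≤ τ.toFun z := by
  rw [← CFC.posPart_neg]
  exact τ.toFun_posPart_le (neg_mem hy) hz h0 (neg_le.1 h)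

/-- The value of the trace at a self-adjoint operator `y`, read off from its positive and negative
parts. It is meaningful if both have finite trace: `τ.tr x` is
`τ.realTrace (ℜ x) + i τ.realTrace (ℑ x)`. -/
noncomputable def realTrace (y : H →L[ℂ] H) : ℝ := (τ.toFun y⁺).toReal - (τ.toFun y⁻).toReal

/-- The self-adjoint operators in `N` whose positive and negative parts have finite trace, that is,
the self-adjoint part of `𝓛₁(N, τ)`. -/
structure HasFiniteParts (y : H →L[ℂ] H) : Prop where
  mem : y ∈ N
  isSelfAdjoint : IsSelfAdjoint y
  posPart_lt_top : τ.toFun y⁺ < ∞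
  negPart_lt_top : τ.toFun y⁻ < ∞

/-- The operators whose real and imaginary parts have positive and negative parts of finite trace.
On these operators `τ.tr` is additive. -/
def HasFiniteTrace (x : H →L[ℂ] H) : Prop :=
  τ.HasFiniteParts (ℜ x) ∧ τ.HasFiniteParts (ℑ x)

variable {τ}

theorem realTrace_sub_of_nonneg {a b : H →L[ℂ] H} (ha : a ∈ N) (hb : b ∈ N) (ha0 : 0 ≤ a)
    (hb0 : 0 ≤ b) (ha_top : τ.toFun a < ∞) (hb_top : τ.toFun b < ∞) :
    τ.realTrace (a - b) = (τ.toFun a).toReal - (τ.toFun b).toReal := by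
  have hab : a - b ∈ N := sub_mem ha hb
  have hpos_top : τ.toFun (a - b)⁺ < ∞ :=
    (τ.toFun_posPart_le hab ha ha0 (sub_le_self a hb0)).trans_lt ha_top
  have hneg_top : τ.toFun (a - b)⁻ < ∞ :=
    (τ.toFun_negPart_le hab hb hb0 (by simpa [sub_eq_add_neg] using ha0)).trans_lt hb_top
  have hparts : (a - b)⁺ + b = a + (a - b)⁻ := by
    have h := CFC.posPart_sub_negPart (a - b) (ha0.isSelfAdjoint.sub hb0.isSelfAdjoint)
    rw [sub_eq_sub_iff_add_eq_add] at h
    exact h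
  have htrace := congrArg (fun x ↦ (τ.toFun x).toReal) hparts
  simp only [τ.add _ (posPart_mem hab) _ hb (CFC.posPart_nonneg _) hb0,
    τ.add _ ha _ (negPart_mem hab) ha0 (CFC.negPart_nonneg _),
    ENNReal.toReal_add hpos_top.ne hb_top.ne, ENNReal.toReal_add ha_top.ne hneg_top.ne] at htrace
  rw [realTrace]
  linarith

theorem realTrace_sub {y z : H →L[ℂ] H} (hy : τ.HasFiniteParts y) (hz : τ.HasFiniteParts z) :
    τ.realTrace (y - z) = τ.realTrace y - τ.realTrace z := by
  have hy_pos : y⁺ ∈ N ∧ 0 ≤ y⁺ := ⟨posPart_mem hy.mem, CFC.posPart_nonneg y⟩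
  have hy_neg : y⁻ ∈ N ∧ 0 ≤ y⁻ := ⟨negPart_mem hy.mem, CFC.negPart_nonneg y⟩
  have hz_pos : z⁺ ∈ N ∧ 0 ≤ z⁺ := ⟨posPart_mem hz.mem, CFC.posPart_nonneg z⟩
  have hz_neg : z⁻ ∈ N ∧ 0 ≤ z⁻ := ⟨negPart_mem hz.mem, CFC.negPart_nonneg z⟩
  have hadd_pos := τ.add _ hy_pos.1 _ hz_neg.1 hy_pos.2 hz_neg.2
  have hadd_neg := τ.add _ hy_neg.1 _ hz_pos.1 hy_neg.2 hz_pos.2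
  have hsub : y - z = (y⁺ + z⁻) - (y⁻ + z⁺) := by
    conv_lhs => rw [← CFC.posPart_sub_negPart y hy.isSelfAdjoint,
      ← CFC.posPart_sub_negPart z hz.isSelfAdjoint]
    abel
  rw [hsub, realTrace_sub_of_nonneg (add_mem hy_pos.1 hz_neg.1) (add_mem hy_neg.1 hz_pos.1)
    (add_nonneg hy_pos.2 hz_neg.2) (add_nonneg hy_neg.2 hz_pos.2)
    (hadd_pos ▸ ENNReal.add_lt_top.2 ⟨hy.posPart_lt_top, hz.negPart_lt_top⟩)
    (hadd_neg ▸ ENNReal.add_lt_top.2 ⟨hy.negPart_lt_top, hz.posPart_lt_top⟩), hadd_pos, hadd_neg,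
    ENNReal.toReal_add hy.posPart_lt_top.ne hz.negPart_lt_top.ne,
    ENNReal.toReal_add hy.negPart_lt_top.ne hz.posPart_lt_top.ne, realTrace, realTrace]
  ring

theorem tr_sub {x y : H →L[ℂ] H} (hx : τ.HasFiniteTrace x) (hy : τ.HasFiniteTrace y) :
    τ.tr (x - y) = τ.tr x - τ.tr y := by
  change (τ.realTrace (ℜ (x - y)) + Complex.I * τ.realTrace (ℑ (x - y)) : ℂ) =
    τ.realTrace (ℜ x) + Complex.I * τ.realTrace (ℑ x) -
      (τ.realTrace (ℜ y) + Complex.I * τ.realTrace (ℑ y))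
  rw [map_sub, map_sub, AddSubgroupClass.coe_sub, AddSubgroupClass.coe_sub,
    realTrace_sub hx.1 hy.1, realTrace_sub hx.2 hy.2]
  push_cast
  ring

variable (τ)

theorem realTrace_smul {c : ℝ} (hc : 0 ≤ c) {y : H →L[ℂ] H} (hy : y ∈ N) :
    τ.realTrace (c • y) = c * τ.realTrace y := by
  rw [realTrace, realTrace, CFC.posPart_smul_of_nonneg hc, CFC.negPart_smul_of_nonneg hc,
    τ.toFun_real_smul hc (posPart_mem hy) (CFC.posPart_nonneg y),
    τ.toFun_real_smul hc (negPart_mem hy) (CFC.negPart_nonneg y), ENNReal.toReal_mul,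
    ENNReal.toReal_mul, ENNReal.toReal_ofReal hc, mul_sub]

theorem tr_real_smul {c : ℝ} (hc : 0 ≤ c) {x : H →L[ℂ] H} (hx : x ∈ N) :
    τ.tr (c • x) = c * τ.tr x := by
  change (τ.realTrace (ℜ (c • x)) + Complex.I * τ.realTrace (ℑ (c • x)) : ℂ) =
    c * (τ.realTrace (ℜ x) + Complex.I * τ.realTrace (ℑ x))
  rw [map_smul, map_smul, selfAdjoint.val_smul, selfAdjoint.val_smul,
    τ.realTrace_smul hc (realPart_mem hx), τ.realTrace_smul hc (imaginaryPart_mem hx)]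
  push_cast
  ring

theorem enorm_realTrace_le {y z : H →L[ℂ] H} (hy : y ∈ N) (hz : z ∈ N) (h0 : 0 ≤ z)
    (hle : y ∈ Icc (-z) z) : ‖τ.realTrace y‖ₑ ≤ τ.toFun z := by
  rcases eq_top_or_lt_top (τ.toFun z) with htop | htop
  · exact htop ▸ le_top
  rw [Real.enorm_eq_ofReal_abs, ENNReal.ofReal_le_iff_le_toReal htop.ne]
  have hpos := ENNReal.toReal_mono htop.ne (τ.toFun_posPart_le hy hz h0 hle.2)
  have hneg := ENNReal.toReal_mono htop.ne (τ.toFun_negPart_le hy hz h0 hle.1)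
  refine abs_sub_le_iff.2 ⟨?_, ?_⟩
  · exact (sub_le_self _ ENNReal.toReal_nonneg).trans hpos
  · exact (sub_le_self _ ENNReal.toReal_nonneg).trans hneg

theorem realPart_star_mul_le (p q : H →L[ℂ] H) :
    (ℜ (star p * q) : H →L[ℂ] H) ≤ (2⁻¹ : ℝ) • (star p * p + star q * q) := by
  rw [realPart_apply_coe]
  refine smul_le_smul_of_nonneg_left ?_ (by positivity)
  have hsq := star_mul_self_nonneg (p - q)
  have hexpand : star (p - q) * (p - q) =
      star p * p + star q * q - (star p * q + star (star p * q)) := by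
    simp only [star_sub, star_mul, star_star, sub_mul, mul_sub]
    abel
  rw [hexpand] at hsq
  exact sub_nonneg.1 hsq

theorem realPart_star_mul_mem_Icc (p q : H →L[ℂ] H) :
    (ℜ (star p * q) : H →L[ℂ] H) ∈
      Icc (-((2⁻¹ : ℝ) • (star p * p + star q * q))) ((2⁻¹ : ℝ) • (star p * p + star q * q)) := by
  refine ⟨neg_le.1 ?_, realPart_star_mul_le p q⟩
  simpa only [mul_neg, map_neg, NegMemClass.coe_neg, star_neg, neg_mul, neg_neg] using
    realPart_star_mul_le p (-q)

theorem imaginaryPart_star_mul_mem_Icc (p q : H →L[ℂ] H) :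
    (ℑ (star p * q) : H →L[ℂ] H) ∈
      Icc (-((2⁻¹ : ℝ) • (star p * p + star q * q))) ((2⁻¹ : ℝ) • (star p * p + star q * q)) := by
  have him : ℜ (star p * (-Complex.I • q)) = ℑ (star p * q) := by
    rw [mul_smul_comm, neg_smul, map_neg, realPart_I_smul, neg_neg]
  have hqq : star (-Complex.I • q) * (-Complex.I • q) = star q * q := by
    rw [star_smul, smul_mul_smul_comm]
    simp
  simpa only [him, hqq] using realPart_star_mul_mem_Icc p (-Complex.I • q)

theorem toFun_half_smul_add {a b : H →L[ℂ] H} (ha : a ∈ N) (hb : b ∈ N) (ha0 : 0 ≤ a)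
    (hb0 : 0 ≤ b) :
    τ.toFun ((2⁻¹ : ℝ) • (a + b)) + τ.toFun ((2⁻¹ : ℝ) • (a + b)) = τ.toFun a + τ.toFun b := by
  rw [← two_mul, τ.toFun_real_smul (by positivity) (add_mem ha hb) (add_nonneg ha0 hb0),
    τ.add _ ha _ hb ha0 hb0, ENNReal.ofReal_inv_of_pos two_pos, ENNReal.ofReal_ofNat,
    ENNReal.mul_inv_cancel_left two_ne_zero ENNReal.ofNat_ne_top]

variable {p q : H →L[ℂ] H}

theorem enorm_tr_star_mul_le (hp : p ∈ N) (hq : q ∈ N) :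
    ‖τ.tr (star p * q)‖ₑ ≤ τ.toFun (star p * p) + τ.toFun (star q * q) := by
  have hpq : star p * q ∈ N := mul_mem (star_mem hp) hq
  have hpp : star p * p ∈ N := mul_mem (star_mem hp) hp
  have hqq : star q * q ∈ N := mul_mem (star_mem hq) hq
  set z := (2⁻¹ : ℝ) • (star p * p + star q * q)
  have hz : z ∈ N := real_smul_mem _ (add_mem hpp hqq)
  have hz0 : 0 ≤ z := smul_nonneg (by positivity)
    (add_nonneg (star_mul_self_nonneg p) (star_mul_self_nonneg q))
  calc ‖τ.tr (star p * q)‖ₑ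
      ≤ ‖(τ.realTrace (ℜ (star p * q)) : ℂ)‖ₑ +
          ‖Complex.I * (τ.realTrace (ℑ (star p * q)) : ℂ)‖ₑ := enorm_add_le _ _
    _ = ‖τ.realTrace (ℜ (star p * q))‖ₑ + ‖τ.realTrace (ℑ (star p * q))‖ₑ := by
        simp only [enorm_eq_nnnorm, nnnorm_mul, Complex.nnnorm_I, one_mul, Complex.nnnorm_real]
    _ ≤ τ.toFun z + τ.toFun z := add_le_add
        (τ.enorm_realTrace_le (realPart_mem hpq) hz hz0 (realPart_star_mul_mem_Icc p q))
        (τ.enorm_realTrace_le (imaginaryPart_mem hpq) hz hz0 (imaginaryPart_star_mul_mem_Icc p q))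
    _ = τ.toFun (star p * p) + τ.toFun (star q * q) :=
        τ.toFun_half_smul_add hpp hqq (star_mul_self_nonneg p) (star_mul_self_nonneg q)

theorem hasFiniteTrace_star_mul (hp : p ∈ N) (hq : q ∈ N) (hp_top : τ.toFun (star p * p) < ∞)
    (hq_top : τ.toFun (star q * q) < ∞) : τ.HasFiniteTrace (star p * q) := by
  have hpq : star p * q ∈ N := mul_mem (star_mem hp) hq
  have hpp : star p * p ∈ N := mul_mem (star_mem hp) hp
  have hqq : star q * q ∈ N := mul_mem (star_mem hq) hq
  have hz : (2⁻¹ : ℝ) • (star p * p + star q * q) ∈ N := real_smul_mem _ (add_mem hpp hqq)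
  have hz0 : 0 ≤ (2⁻¹ : ℝ) • (star p * p + star q * q) := smul_nonneg (by positivity)
    (add_nonneg (star_mul_self_nonneg p) (star_mul_self_nonneg q))
  have hz_top : τ.toFun ((2⁻¹ : ℝ) • (star p * p + star q * q)) < ∞ := by
    refine lt_of_le_of_lt le_self_add ((τ.toFun_half_smul_add hpp hqq (star_mul_self_nonneg p)
      (star_mul_self_nonneg q)).trans_lt (ENNReal.add_lt_top.2 ⟨hp_top, hq_top⟩))
  have hparts : ∀ y ∈ selfAdjoint (H →L[ℂ] H), y ∈ N →
      y ∈ Icc (-((2⁻¹ : ℝ) • (star p * p + star q * q)))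
        ((2⁻¹ : ℝ) • (star p * p + star q * q)) → τ.HasFiniteParts y :=
    fun y hsa hy h ↦ ⟨hy, hsa, (τ.toFun_posPart_le hy hz hz0 h.2).trans_lt hz_top,
      (τ.toFun_negPart_le hy hz hz0 h.1).trans_lt hz_top⟩
  exact ⟨hparts _ (ℜ (star p * q)).2 (realPart_mem hpq) (realPart_star_mul_mem_Icc p q),
    hparts _ (ℑ (star p * q)).2 (imaginaryPart_mem hpq) (imaginaryPart_star_mul_mem_Icc p q)⟩

theorem star_mul_mem_L1 (hp : p ∈ N) (hq : q ∈ N) (hp_top : τ.toFun (star p * p) < ∞)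
    (hq_top : τ.toFun (star q * q) < ∞) : star p * q ∈ τ.L1 := by
  refine ⟨mul_mem (star_mem hp) hq, ?_⟩
  have htwo := (τ.two_mul_toFun_abs_star_mul_le hp hq).trans_lt
    (ENNReal.add_lt_top.2 ⟨hp_top, hq_top⟩)
  exact ENNReal.lt_top_of_mul_ne_top_right htwo.ne two_ne_zero

end FNSTrace

section OpFun

variable {H : Type*} [NormedAddCommGroup H] [InnerProductSpace ℂ H] [CompleteSpace H]
  {A : H →L[ℂ] H}

theorem re_mem_spectrum_real (hA : IsSelfAdjoint A) {z : ℂ} (hz : z ∈ spectrum ℂ A) :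
    z.re ∈ spectrum ℝ A := by
  rw [← hA.spectrumRestricts.algebraMap_image] at hz
  obtain ⟨x, hx, rfl⟩ := hz
  simpa using hx

theorem continuousOn_comp_re (hA : IsSelfAdjoint A) {f : ℝ → ℂ}
    (hf : ContinuousOn f (spectrum ℝ A)) : ContinuousOn (fun z : ℂ ↦ f z.re) (spectrum ℂ A) :=
  hf.comp Complex.continuous_re.continuousOn fun _ hz ↦ re_mem_spectrum_real hA hz

theorem opFun_mul (hA : IsSelfAdjoint A) {f g : ℝ → ℂ}
    (hf : ContinuousOn f (spectrum ℝ A)) (hg : ContinuousOn g (spectrum ℝ A)) :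
    opFun (fun x ↦ f x * g x) A = opFun f A * opFun g A :=
  cfc_mul _ _ A (continuousOn_comp_re hA hf) (continuousOn_comp_re hA hg)

theorem opFun_sub (hA : IsSelfAdjoint A) {f g : ℝ → ℂ}
    (hf : ContinuousOn f (spectrum ℝ A)) (hg : ContinuousOn g (spectrum ℝ A)) :
    opFun (fun x ↦ f x - g x) A = opFun f A - opFun g A :=
  cfc_sub _ _ A (continuousOn_comp_re hA hf) (continuousOn_comp_re hA hg)

theorem opFun_real_const_mul (hA : IsSelfAdjoint A) (c : ℝ) {f : ℝ → ℂ}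
    (hf : ContinuousOn f (spectrum ℝ A)) :
    opFun (fun x ↦ (c : ℂ) * f x) A = c • opFun f A := by
  rw [opFun, cfc_const_mul (c : ℂ) (fun z : ℂ ↦ f z.re) A (continuousOn_comp_re hA hf),
    Complex.coe_smul, opFun]

theorem star_opFun (f : ℝ → ℂ) (A : H →L[ℂ] H) :
    star (opFun f A) = opFun (fun x ↦ star (f x)) A :=
  (cfc_star _ A).symm

theorem opFun_ofReal (hA : IsSelfAdjoint A) (φ : ℝ → ℝ) :
    opFun (fun x ↦ (φ x : ℂ)) A = cfc φ A :=
  (cfc_real_eq_complex φ hA).symm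

theorem opFun_smul (hA : IsSelfAdjoint A) (t : ℝ) {f : ℝ → ℂ}
    (hf : ContinuousOn f ((fun x ↦ t * x) '' spectrum ℝ A)) :
    opFun f ((t : ℂ) • A) = opFun (fun x ↦ f (t * x)) A := by
  have hcomp := cfc_comp_const_mul (t : ℂ) (fun z : ℂ ↦ f z.re) A ?_ hA.isStarNormal
  · rw [opFun, ← hcomp, opFun]
    simp only [Complex.re_ofReal_mul]
  · refine hf.comp Complex.continuous_re.continuousOn ?_
    rintro _ ⟨z, hz, rfl⟩
    exact ⟨z.re, re_mem_spectrum_real hA hz, by simp⟩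

theorem opFun_mem {N : VonNeumannAlgebra H} (f : ℝ → ℂ) (hA : A ∈ N) : opFun f A ∈ N :=
  cfc_mem (𝕜' := ℂ) _ hA

theorem norm_div_sqrt_norm (z : ℂ) : ‖z / (√‖z‖ : ℂ)‖ = √‖z‖ := by
  rw [norm_div, Complex.norm_real, Real.norm_of_nonneg (Real.sqrt_nonneg _), Real.div_sqrt]

theorem div_sqrt_norm_mul_sqrt_norm (z : ℂ) : z / (√‖z‖ : ℂ) * (√‖z‖ : ℂ) = z := by
  rcases eq_or_ne z 0 with rfl | hz
  · simp
  · exact div_mul_cancel₀ z (Complex.ofReal_ne_zero.2 (Real.sqrt_ne_zero'.2 (norm_pos_iff.2 hz)))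

theorem continuous_div_sqrt_norm : Continuous fun z : ℂ ↦ z / (√‖z‖ : ℂ) := by
  refine continuous_iff_continuousAt.2 fun z ↦ ?_
  rcases eq_or_ne z 0 with rfl | hz
  · have hlim : Filter.Tendsto (fun z : ℂ ↦ √‖z‖) (nhds 0) (nhds 0) :=
      Continuous.tendsto' (by fun_prop) 0 0 (by simp)
    rw [ContinuousAt, zero_div]
    exact squeeze_zero_norm (fun z ↦ (norm_div_sqrt_norm z).le) hlim
  · exact ContinuousAt.div (by fun_prop) (by fun_prop)
      (Complex.ofReal_ne_zero.2 (Real.sqrt_ne_zero'.2 (norm_pos_iff.2 hz)))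

end OpFun

namespace FNSTrace

variable {H : Type*} [NormedAddCommGroup H] [InnerProductSpace ℂ H] [CompleteSpace H]
  {N : VonNeumannAlgebra H} {A B : H →L[ℂ] H} {g : ℝ → ℂ}

theorem exists_opFun_mul_eq_star_mul (hA : A ∈ N) (hsa : IsSelfAdjoint A) (hB : B ∈ N)
    (hg : ContinuousOn g (spectrum ℝ A)) :
    ∃ p ∈ N, ∃ q ∈ N, opFun g A * B = star p * q ∧ star p * p = cfc (fun x ↦ ‖g x‖) A ∧
      star q * q = star B * cfc (fun x ↦ ‖g x‖) A * B := by
  set r : ℝ → ℝ := fun x ↦ √‖g x‖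
  set b : ℝ → ℂ := fun x ↦ g x / (√‖g x‖ : ℂ)
  have hr : ContinuousOn r (spectrum ℝ A) := hg.norm.sqrt
  have hrc : ContinuousOn (fun x ↦ (r x : ℂ)) (spectrum ℝ A) :=
    Complex.continuous_ofReal.comp_continuousOn hr
  have hb : ContinuousOn b (spectrum ℝ A) := continuous_div_sqrt_norm.comp_continuousOn hg
  have hbr : opFun b A * cfc r A = opFun g A := by
    rw [← opFun_ofReal hsa, ← opFun_mul hsa hb hrc]
    exact congrArg (opFun · A) (funext fun x ↦ div_sqrt_norm_mul_sqrt_norm (g x))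
  have hbb : opFun b A * star (opFun b A) = cfc (fun x ↦ ‖g x‖) A := by
    rw [star_opFun, ← opFun_mul hsa hb hb.star, ← opFun_ofReal hsa]
    refine congrArg (opFun · A) (funext fun x ↦ ?_)
    rw [Complex.star_def, Complex.mul_conj, Complex.normSq_eq_norm_sq, norm_div_sqrt_norm,
      Real.sq_sqrt (norm_nonneg _)]
  have hrr : star (cfc r A) * cfc r A = cfc (fun x ↦ ‖g x‖) A := by
    rw [IsSelfAdjoint.cfc.star_eq, ← cfc_mul r r A hr hr]
    simp only [r, Real.mul_self_sqrt (norm_nonneg _)]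
  refine ⟨star (opFun b A), star_mem (opFun_mem b hA), cfc r A * B,
    mul_mem (cfc_real_mem r hA) hB, ?_, ?_, ?_⟩
  · rw [star_star, ← mul_assoc, hbr]
  · rw [star_star, hbb]
  · rw [star_mul, ← hrr]
    simp only [mul_assoc]

variable (τ : FNSTrace N)

theorem opFun_mul_mem_L1 (hA : A ∈ N) (hsa : IsSelfAdjoint A) (hB : B ∈ N)
    (hg : ContinuousOn g (spectrum ℝ A)) (htop : τ.toFun (cfc (fun x ↦ ‖g x‖) A) < ∞) :
    opFun g A * B ∈ τ.L1 ∧ τ.HasFiniteTrace (opFun g A * B) := by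
  obtain ⟨p, hp, q, hq, hpq, hpp, hqq⟩ := exists_opFun_mul_eq_star_mul hA hsa hB hg
  have hp_top : τ.toFun (star p * p) < ∞ := hpp ▸ htop
  have hq_top : τ.toFun (star q * q) < ∞ := by
    rw [hqq]
    exact (τ.toFun_conj_le (cfc_real_mem _ hA) hB (cfc_nonneg fun _ _ ↦ norm_nonneg _)).trans_lt
      (ENNReal.mul_lt_top ENNReal.ofReal_lt_top htop)
  rw [hpq]
  exact ⟨τ.star_mul_mem_L1 hp hq hp_top hq_top, τ.hasFiniteTrace_star_mul hp hq hp_top hq_top⟩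

theorem enorm_tr_opFun_mul_le (hA : A ∈ N) (hsa : IsSelfAdjoint A) (hB : B ∈ N)
    (hg : ContinuousOn g (spectrum ℝ A)) {φ : ℝ → ℝ} (hφ : ContinuousOn φ (spectrum ℝ A))
    (hle : ∀ x ∈ spectrum ℝ A, ‖g x‖ ≤ φ x) :
    ‖τ.tr (opFun g A * B)‖ₑ ≤ ENNReal.ofReal (1 + ‖B‖ ^ 2) * τ.toFun (cfc φ A) := by
  obtain ⟨p, hp, q, hq, hpq, hpp, hqq⟩ := exists_opFun_mul_eq_star_mul hA hsa hB hg
  calc ‖τ.tr (opFun g A * B)‖ₑ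
      ≤ τ.toFun (star p * p) + τ.toFun (star q * q) := hpq ▸ τ.enorm_tr_star_mul_le hp hq
    _ ≤ τ.toFun (cfc (fun x ↦ ‖g x‖) A) +
          ENNReal.ofReal (‖B‖ ^ 2) * τ.toFun (cfc (fun x ↦ ‖g x‖) A) := by
        rw [hpp, hqq]
        gcongr
        exact τ.toFun_conj_le (cfc_real_mem _ hA) hB (cfc_nonneg fun _ _ ↦ norm_nonneg _)
    _ = ENNReal.ofReal (1 + ‖B‖ ^ 2) * τ.toFun (cfc (fun x ↦ ‖g x‖) A) := by
        rw [ENNReal.ofReal_add zero_le_one (by positivity), ENNReal.ofReal_one, add_mul, one_mul]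
    _ ≤ ENNReal.ofReal (1 + ‖B‖ ^ 2) * τ.toFun (cfc φ A) := by
        gcongr
        exact τ.toFun_cfc_mono hA hg.norm hφ (fun _ _ ↦ norm_nonneg _) hle

/- Otherwise the traces of `(φ - δ)⁺(A)` would stay below `τ(φ(A)) - ε`, against normality. -/
theorem exists_toFun_cfc_min_le (hA : A ∈ N) (hsa : IsSelfAdjoint A) {φ : ℝ → ℝ}
    (hφ : ContinuousOn φ (spectrum ℝ A)) (h0 : ∀ x ∈ spectrum ℝ A, 0 ≤ φ x)
    (htop : τ.toFun (cfc φ A) < ∞) {ε : ℝ≥0∞} (hε : 0 < ε) :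
    ∃ δ : ℝ, 0 < δ ∧ τ.toFun (cfc (fun x ↦ min δ (φ x)) A) ≤ ε := by
  by_contra! hlarge
  have hcut : τ.toFun (cfc φ A) ≤ τ.toFun (cfc φ A) - ε := by
    refine τ.toFun_cfc_le_of_forall_pos hA hsa hφ h0 fun δ hδ ↦ ?_
    have hsplit : τ.toFun (cfc φ A) = τ.toFun (cfc (fun x ↦ max (φ x - δ) 0) A) +
        τ.toFun (cfc (fun x ↦ min δ (φ x)) A) := by
      rw [← τ.toFun_cfc_add hA (by fun_prop) (by fun_prop) (fun _ _ ↦ le_max_right _ _)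
        fun x hx ↦ le_min hδ.le (h0 x hx)]
      refine congrArg τ.toFun (cfc_congr fun x _ ↦ ?_)
      rcases le_total δ (φ x) with h | h <;> simp [h]
    exact ENNReal.le_sub_of_add_le_right (ne_top_of_lt (hlarge δ hδ))
      ((add_le_add_right (hlarge δ hδ).le _).trans hsplit.ge)
  have hpos : τ.toFun (cfc φ A) ≠ 0 := by
    intro hzero
    refine ((hlarge 1 one_pos).trans_le ?_).not_ge (zero_le (a := ε))
    exact (τ.toFun_cfc_mono hA (by fun_prop) hφ (fun x hx ↦ le_min zero_le_one (h0 x hx))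
      fun x _ ↦ min_le_right _ _).trans hzero.le
  exact (ENNReal.sub_lt_self htop.ne hpos hε.ne').not_ge hcut

theorem continuousOn_tr_opFun_mul {X : Type*} [TopologicalSpace X] {S : Set X} {g : X → ℝ → ℂ}
    (hA : A ∈ N) (hsa : IsSelfAdjoint A) (hB : B ∈ N)
    (hg : ContinuousOn g.uncurry (S ×ˢ spectrum ℝ A))
    {φ : ℝ → ℝ} (hφ : ContinuousOn φ (spectrum ℝ A)) (htop : τ.toFun (cfc φ A) < ∞)
    (hle : ∀ s ∈ S, ∀ x ∈ spectrum ℝ A, ‖g s x‖ ≤ φ x) :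
    ContinuousOn (fun s ↦ τ.tr (opFun (g s) A * B)) S := by
  have hgs : ∀ s ∈ S, ContinuousOn (g s) (spectrum ℝ A) := fun s hs ↦
    hg.comp (f := fun x ↦ (s, x)) (by fun_prop) fun x hx ↦ ⟨hs, hx⟩
  intro s hs
  have hφ0 : ∀ x ∈ spectrum ℝ A, 0 ≤ φ x := fun x hx ↦ (norm_nonneg _).trans (hle s hs x hx)
  have htop' : ∀ s ∈ S, τ.toFun (cfc (fun x ↦ ‖g s x‖) A) < ∞ := fun s hs ↦
    (τ.toFun_cfc_mono hA (hgs s hs).norm hφ (fun _ _ ↦ norm_nonneg _) (hle s hs)).trans_lt htop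
  refine EMetric.tendsto_nhds.2 fun ε hε ↦ ?_
  obtain ⟨δ, hδ, hδε⟩ : ∃ δ : ℝ, 0 < δ ∧ ENNReal.ofReal (1 + ‖B‖ ^ 2) *
      τ.toFun (cfc (fun x ↦ min δ (2 * φ x)) A) < ε := by
    obtain ⟨η, hη, hηε⟩ := ENNReal.exists_pos_mul_lt (a := ENNReal.ofReal (1 + ‖B‖ ^ 2))
      ENNReal.ofReal_ne_top hε.ne'
    obtain ⟨δ, hδ, hδη⟩ := τ.exists_toFun_cfc_min_le (φ := fun x ↦ 2 * φ x) hA hsa (by fun_prop)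
      (fun x hx ↦ mul_nonneg zero_le_two (hφ0 x hx))
      (by
        rw [τ.toFun_cfc_const_mul hA zero_le_two hφ hφ0]
        exact ENNReal.mul_lt_top ENNReal.ofReal_lt_top htop) hη
    exact ⟨δ, hδ, (mul_le_mul_right hδη _).trans_lt (mul_comm _ η ▸ hηε)⟩
  have hunif : ∀ᶠ s' in nhdsWithin s S, ∀ x ∈ spectrum ℝ A, dist (g s' x) (g s x) < δ := by
    obtain ⟨V, hV, hclose⟩ :=
      (ContinuousFunctionalCalculus.isCompact_spectrum A).mem_uniformity_of_prod
        hg hs (Metric.dist_mem_uniformity hδ)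
    exact Filter.eventually_of_mem hV hclose
  filter_upwards [hunif, self_mem_nhdsWithin] with s' hclose hs'
  rw [edist_eq_enorm_sub, ← tr_sub (τ.opFun_mul_mem_L1 hA hsa hB (hgs s' hs') (htop' s' hs')).2
    (τ.opFun_mul_mem_L1 hA hsa hB (hgs s hs) (htop' s hs)).2, ← sub_mul,
    ← opFun_sub hsa (hgs s' hs') (hgs s hs)]
  refine (τ.enorm_tr_opFun_mul_le (g := fun x ↦ g s' x - g s x) hA hsa hB
    ((hgs s' hs').sub (hgs s hs)) (by fun_prop) fun x hx ↦ le_min ?_ ?_).trans_lt hδε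
  · rw [← dist_eq_norm]
    exact (hclose x hx).le
  · linarith [norm_sub_le (g s' x) (g s x), hle s hs x hx, hle s' hs' x hx]

end FNSTrace

/-- A continuous substitute for the indicator function of `[2l, ∞)`, `l > 0`: it vanishes on
`(-∞, l]` and equals `1` on `[2l, ∞)`. -/
noncomputable def levelCutoff (l x : ℝ) : ℝ := min 1 (max 0 (x / l - 1))

@[fun_prop]
theorem continuous_levelCutoff (l : ℝ) : Continuous (levelCutoff l) := by
  unfold levelCutoff
  fun_prop

theorem levelCutoff_nonneg (l x : ℝ) : 0 ≤ levelCutoff l x :=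
  le_min zero_le_one (le_max_left _ _)

theorem levelCutoff_le_one (l x : ℝ) : levelCutoff l x ≤ 1 := min_le_left _ _

theorem levelCutoff_eq_zero {l x : ℝ} (hl : 0 < l) (h : x ≤ l) : levelCutoff l x = 0 := by
  rw [levelCutoff, max_eq_left (sub_nonpos.2 ((div_le_one hl).2 h)), min_eq_right zero_le_one]

theorem levelCutoff_eq_one {l x : ℝ} (hl : 0 < l) (h : 2 * l ≤ x) : levelCutoff l x = 1 :=
  min_eq_left (le_max_of_le_right (by linarith [(le_div_iff₀ hl).2 h]))

section AbelSummation

variable {φ : ℝ → ℝ} (hφ : MonotoneOn φ (Ici 0)) {l : ℕ → ℝ} (hl0 : ∀ k, 0 ≤ l k)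

include hφ hl0

theorem le_add_sum_sub_mul (hl : Antitone l) {w : ℕ → ℝ} (hw : ∀ k, 0 ≤ w k) {x : ℝ}
    (hx : 0 ≤ x) (hxl : x ≤ l 0) (hwx : ∀ k, l (k + 1) ≤ x → 1 ≤ w k) (K : ℕ) :
    φ x ≤ φ (l K) + ∑ k ∈ Finset.range K, (φ (l k) - φ (l (k + 1))) * w k := by
  have hstep : ∀ k, 0 ≤ φ (l k) - φ (l (k + 1)) := fun k ↦
    sub_nonneg.2 (hφ (hl0 _) (hl0 _) (hl k.le_succ))
  induction K with
  | zero => simpa using hφ hx (hl0 0) hxl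
  | succ K ih =>
    rcases le_total (l (K + 1)) x with h | h
    · rw [Finset.sum_range_succ]
      linarith [mul_le_mul_of_nonneg_left (hwx K h) (hstep K)]
    · exact (hφ hx (hl0 _) h).trans
        (le_add_of_nonneg_right (Finset.sum_nonneg fun k _ ↦ mul_nonneg (hstep k) (hw k)))

theorem sum_sub_mul_indicator_le (hφ0 : φ 0 = 0) {z : ℝ} (hz : 0 ≤ z) (K : ℕ) :
    ∑ k ∈ Finset.range K, (φ (l k) - φ (l (k + 1))) * (Ici (l k)).indicator 1 z ≤ φ z := by
  have hnonneg : ∀ {y}, 0 ≤ y → 0 ≤ φ y := fun hy ↦ hφ0 ▸ hφ self_mem_Ici hy hy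
  suffices h : ∑ k ∈ Finset.range K, (φ (l k) - φ (l (k + 1))) * (Ici (l k)).indicator 1 z ≤
      max 0 (φ z - φ (l K)) from
    h.trans (max_le (hnonneg hz) (sub_le_self _ (hnonneg (hl0 K))))
  induction K with
  | zero => simp
  | succ K ih =>
    rw [Finset.sum_range_succ]
    rcases le_or_gt (l K) z with h | h
    · rw [max_eq_right (sub_nonneg.2 (hφ (hl0 K) hz h))] at ih
      rw [indicator_of_mem (mem_Ici.2 h), Pi.one_apply, mul_one]
      exact le_max_of_le_right (by linarith)
    · rw [max_eq_left (sub_nonpos.2 (hφ hz (hl0 K) h.le))] at ih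
      rw [indicator_of_notMem (notMem_Ici.2 h), mul_zero, add_zero]
      exact le_max_of_le_left ih

end AbelSummation

namespace FNSTrace

variable {H : Type*} [NormedAddCommGroup H] [InnerProductSpace ℂ H] [CompleteSpace H]
  {N : VonNeumannAlgebra H} (τ : FNSTrace N)

theorem singularValue_nonneg (t : ℝ) (A : H →L[ℂ] H) : 0 ≤ τ.singularValue t A := by
  refine Real.sInf_nonneg ?_
  rintro _ ⟨p, -, -, -, rfl⟩
  exact norm_nonneg _

theorem singularValue_set_nonempty (t : ℝ) (A : H →L[ℂ] H) :
    {r : ℝ | ∃ p ∈ N, IsStarProjection p ∧ τ.toFun (1 - p) ≤ ENNReal.ofReal t ∧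
      r = ‖A * p‖}.Nonempty :=
  ⟨_, 1, one_mem N, .one _, by simp [τ.toFun_zero], rfl⟩

theorem antitone_singularValue (A : H →L[ℂ] H) : Antitone fun t ↦ τ.singularValue t A := by
  intro s t hst
  refine csInf_le_csInf ⟨0, ?_⟩ (τ.singularValue_set_nonempty s A) ?_
  · rintro _ ⟨p, -, -, -, rfl⟩
    exact norm_nonneg _
  · rintro _ ⟨p, hp, hproj, hle, rfl⟩
    exact ⟨p, hp, hproj, hle.trans (ENNReal.ofReal_le_ofReal hst), rfl⟩

variable {A p : H →L[ℂ] H}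

theorem cfc_mul_projection_mul_cfc_le (hsa : IsSelfAdjoint A) (hproj : IsStarProjection p)
    {γ : ℝ → ℝ} (hγ : ContinuousOn γ (spectrum ℝ A)) :
    cfc (fun x ↦ x * γ x) A * p * cfc (fun x ↦ x * γ x) A ≤
      cfc (fun x ↦ ‖A * p‖ ^ 2 * γ x ^ 2) A := by
  have hG_star : star (cfc γ A) = cfc γ A := IsSelfAdjoint.cfc
  have hAG : cfc (fun x ↦ x * γ x) A = A * cfc γ A := by
    rw [cfc_mul (fun x ↦ x) γ A continuousOn_id hγ, cfc_id' ℝ A]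
  have hGA : cfc (fun x ↦ x * γ x) A = cfc γ A * A := by
    simp only [mul_comm _ (γ _)]
    rw [cfc_mul γ (fun x ↦ x) A hγ continuousOn_id, cfc_id' ℝ A]
  have hAp : A * p * star (A * p) = A * p * A := by
    rw [star_mul, hproj.isSelfAdjoint.star_eq, hsa.star_eq, ← mul_assoc, mul_assoc A p p,
      hproj.isIdempotentElem.eq]
  calc cfc (fun x ↦ x * γ x) A * p * cfc (fun x ↦ x * γ x) A
      = cfc γ A * A * p * (A * cfc γ A) := by rw [← hGA, ← hAG]
    _ = star (cfc γ A) * (A * p * star (A * p)) * cfc γ A := by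
        rw [hG_star, hAp]
        simp only [mul_assoc]
    _ ≤ star (cfc γ A) * algebraMap ℝ _ (‖A * p‖ ^ 2) * cfc γ A :=
        star_left_conjugate_le_conjugate CStarAlgebra.mul_star_le_algebraMap_norm_sq _
    _ = cfc (fun x ↦ ‖A * p‖ ^ 2 * γ x ^ 2) A := by
        rw [hG_star, ← (Algebra.commutes _ (cfc γ A)), mul_assoc, ← Algebra.smul_def,
          cfc_const_mul _ (fun x ↦ γ x ^ 2) A (hγ.pow 2), cfc_pow γ 2 A hγ, pow_two (cfc γ A)]

theorem toFun_cfc_le_toFun_one_sub (hA : A ∈ N) (hsa : IsSelfAdjoint A) (hp : p ∈ N)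
    (hproj : IsStarProjection p) {γ ψ : ℝ → ℝ} (hγ : ContinuousOn γ (spectrum ℝ A))
    (hψ : ContinuousOn ψ (spectrum ℝ A)) (hγ1 : ∀ x ∈ spectrum ℝ A, ‖x * γ x‖ ≤ 1)
    (hψ0 : ∀ x ∈ spectrum ℝ A, 0 ≤ ψ x)
    (hψγ : ∀ x ∈ spectrum ℝ A, ψ x ≤ (x * γ x) ^ 2 - ‖A * p‖ ^ 2 * γ x ^ 2) :
    τ.toFun (cfc ψ A) ≤ τ.toFun (1 - p) := by
  set R := cfc (fun x ↦ x * γ x) A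
  have hR : R ∈ N := cfc_real_mem _ hA
  have hR_star : star R = R := IsSelfAdjoint.cfc
  have hxγ : ContinuousOn (fun x ↦ x * γ x) (spectrum ℝ A) := continuousOn_id.mul hγ
  have hcompl : 1 - p ∈ N := sub_mem (one_mem N) hp
  calc τ.toFun (cfc ψ A) ≤ τ.toFun (star R * (1 - p) * R) := by
        refine τ.toFun_mono (cfc_real_mem ψ hA)
          (mul_mem (mul_mem (star_mem hR) hcompl) hR) (cfc_nonneg hψ0) ?_
        calc cfc ψ A
            ≤ cfc (fun x ↦ (x * γ x) ^ 2 - ‖A * p‖ ^ 2 * γ x ^ 2) A :=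
              cfc_mono hψγ hψ ((hxγ.pow 2).sub (continuousOn_const.mul (hγ.pow 2)))
          _ = R * R - cfc (fun x ↦ ‖A * p‖ ^ 2 * γ x ^ 2) A := by
              rw [cfc_sub (fun x ↦ (x * γ x) ^ 2) (fun x ↦ ‖A * p‖ ^ 2 * γ x ^ 2) A (hxγ.pow 2)
                (continuousOn_const.mul (hγ.pow 2)), cfc_pow (fun x ↦ x * γ x) 2 A hxγ, pow_two]
          _ ≤ R * R - R * p * R :=
              sub_le_sub_left (cfc_mul_projection_mul_cfc_le hsa hproj hγ) _
          _ = star R * (1 - p) * R := by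
              rw [hR_star, mul_sub, mul_one, sub_mul]
    _ ≤ τ.toFun (1 - p) :=
        τ.toFun_conj_le_of_norm_le_one hcompl hR hproj.one_sub.nonneg
          (norm_cfc_le zero_le_one hγ1)

theorem toFun_cfc_levelCutoff_le_toFun_one_sub (hA : A ∈ N) (hsa : IsSelfAdjoint A) (hp : p ∈ N)
    (hproj : IsStarProjection p) {l : ℝ} (hl : 0 < l) (hAp : ‖A * p‖ ≤ l / 2) :
    τ.toFun (cfc (fun x ↦ 3 / 4 * levelCutoff l x ^ 2) A) ≤ τ.toFun (1 - p) := by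
  have hmax : ∀ x, 0 < max x l := fun x ↦ lt_max_of_lt_right hl
  have hγ : Continuous fun x ↦ levelCutoff l x / max x l :=
    (continuous_levelCutoff l).div (by fun_prop) fun x ↦ (hmax x).ne'
  have hxγ : ∀ x, x * (levelCutoff l x / max x l) = levelCutoff l x := by
    intro x
    rcases le_total x l with hx | hx
    · rw [levelCutoff_eq_zero hl hx, zero_div, mul_zero]
    · rw [max_eq_left hx, mul_div_cancel₀ _ (hl.trans_le hx).ne']
  refine τ.toFun_cfc_le_toFun_one_sub hA hsa hp hproj hγ.continuousOn (by fun_prop)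
    (fun x _ ↦ ?_) (fun x _ ↦ by positivity) fun x _ ↦ ?_
  · rw [hxγ, Real.norm_of_nonneg (levelCutoff_nonneg l x)]
    exact levelCutoff_le_one l x
  · have hquot : ‖A * p‖ ^ 2 * (levelCutoff l x / max x l) ^ 2 ≤ 1 / 4 * levelCutoff l x ^ 2 := by
      calc ‖A * p‖ ^ 2 * (levelCutoff l x / max x l) ^ 2
          = (‖A * p‖ / max x l) ^ 2 * levelCutoff l x ^ 2 := by ring
        _ ≤ (1 / 2) ^ 2 * levelCutoff l x ^ 2 := by
            have hratio : ‖A * p‖ / max x l ≤ 1 / 2 := by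
              rw [div_le_div_iff₀ (hmax x) two_pos]
              linarith [le_max_right x l]
            have := (hmax x).le
            gcongr
        _ = 1 / 4 * levelCutoff l x ^ 2 := by norm_num
    rw [hxγ]
    linarith

theorem volume_setOf_ofReal_lt (T : ℝ≥0∞) :
    volume.restrict (Ioi (0 : ℝ)) {u | ENNReal.ofReal u < T} = T := by
  have hmeas : MeasurableSet {u | ENNReal.ofReal u < T} :=
    measurableSet_lt ENNReal.measurable_ofReal measurable_const
  rw [Measure.restrict_apply hmeas]
  rcases eq_or_ne T ∞ with rfl | hT
  · simp
  · have hIoo : {u | ENNReal.ofReal u < T} ∩ Ioi 0 = Ioo 0 T.toReal := by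
      ext u
      rw [mem_inter_iff, mem_ofPred_eq, mem_Ioi, mem_Ioo, and_comm, and_congr_right_iff]
      exact fun hu ↦ ENNReal.ofReal_lt_iff_lt_toReal hu.le hT
    rw [hIoo, Real.volume_Ioo, sub_zero, ENNReal.ofReal_toReal hT]

theorem toFun_cfc_levelCutoff_le_volume (hA : A ∈ N) (hsa : IsSelfAdjoint A) {l : ℝ} (hl : 0 < l) :
    τ.toFun (cfc (fun x ↦ 3 / 4 * levelCutoff l x ^ 2) A) ≤
      volume.restrict (Ioi (0 : ℝ)) {u | l / 2 ≤ τ.singularValue u A} := by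
  rw [← volume_setOf_ofReal_lt (τ.toFun _)]
  refine measure_mono fun u hu ↦ ?_
  by_contra hlt
  obtain ⟨_, ⟨p, hp, hproj, hpu, rfl⟩, hAp⟩ :=
    exists_lt_of_csInf_lt (τ.singularValue_set_nonempty u A) (not_le.1 hlt)
  exact ((τ.toFun_cfc_levelCutoff_le_toFun_one_sub hA hsa hp hproj hl hAp.le).trans hpu).not_gt hu

end FNSTrace

theorem le_norm_of_mem_spectrum_real {H : Type*} [NormedAddCommGroup H] [InnerProductSpace ℂ H]
    [CompleteSpace H] {A : H →L[ℂ] H} {x : ℝ} (hx : x ∈ spectrum ℝ A) : x ≤ ‖A‖ :=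
  calc x ≤ ‖A‖ * ‖(1 : H →L[ℂ] H)‖ :=
        (le_abs_self x).trans (spectrum.norm_le_norm_mul_of_mem hx)
    _ ≤ ‖A‖ * 1 := mul_le_mul_of_nonneg_left ContinuousLinearMap.norm_id_le (norm_nonneg A)
    _ = ‖A‖ := mul_one _

namespace FNSTrace

variable {H : Type*} [NormedAddCommGroup H] [InnerProductSpace ℂ H] [CompleteSpace H]
  {N : VonNeumannAlgebra H} (τ : FNSTrace N) {A : H →L[ℂ] H} {φ : ℝ → ℝ}

theorem measurable_singularValue (A : H →L[ℂ] H) : Measurable fun t ↦ τ.singularValue t A :=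
  (τ.antitone_singularValue A).measurable

theorem toFun_cfc_mul_levelCutoff_le_lintegral (hA : A ∈ N) (hsa : IsSelfAdjoint A) {c l : ℝ}
    (hc : 0 ≤ c) (hl : 0 < l) :
    τ.toFun (cfc (fun x ↦ c * levelCutoff (l / 4) x ^ 2) A) ≤ ENNReal.ofReal (4 / 3) *
      ∫⁻ u in Ioi 0, ENNReal.ofReal (c * (Ici l).indicator 1 (8 * τ.singularValue u A)) := by
  have hmeas : MeasurableSet {u | l ≤ 8 * τ.singularValue u A} :=
    measurableSet_le measurable_const ((τ.measurable_singularValue A).const_mul 8)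
  have hset : {u | l / 4 / 2 ≤ τ.singularValue u A} = {u | l ≤ 8 * τ.singularValue u A} := by
    ext u
    rw [mem_ofPred_eq, mem_ofPred_eq, div_div, div_le_iff₀ (by norm_num), mul_comm]
    norm_num
  have hind : ∀ u, ENNReal.ofReal (c * (Ici l).indicator 1 (8 * τ.singularValue u A)) =
      {u | l ≤ 8 * τ.singularValue u A}.indicator (fun _ ↦ ENNReal.ofReal c) u := by
    intro u
    by_cases hu : l ≤ 8 * τ.singularValue u A <;> simp [hu]
  calc τ.toFun (cfc (fun x ↦ c * levelCutoff (l / 4) x ^ 2) A)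
      = τ.toFun (cfc (fun x ↦ 4 / 3 * c * (3 / 4 * levelCutoff (l / 4) x ^ 2)) A) := by
        congr 2 with x
        ring
    _ = ENNReal.ofReal (4 / 3 * c) *
        τ.toFun (cfc (fun x ↦ 3 / 4 * levelCutoff (l / 4) x ^ 2) A) :=
      τ.toFun_cfc_const_mul hA (by positivity) (by fun_prop) fun x _ ↦ by positivity
    _ ≤ ENNReal.ofReal (4 / 3 * c) *
        volume.restrict (Ioi (0 : ℝ)) {u | l ≤ 8 * τ.singularValue u A} := by
      rw [← hset]
      exact mul_le_mul_right (τ.toFun_cfc_levelCutoff_le_volume hA hsa (by positivity)) _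
    _ = _ := by
      rw [lintegral_congr hind, lintegral_indicator hmeas, setLIntegral_const,
        ENNReal.ofReal_mul (by norm_num), mul_assoc]

theorem toFun_cfc_sum_levelCutoff_le_lintegral (hA : A ∈ N) (hsa : IsSelfAdjoint A)
    (hφ : MonotoneOn φ (Ici 0)) (hφ0 : φ 0 = 0) {l : ℕ → ℝ} (hl : Antitone l) (hl0 : ∀ k, 0 < l k)
    (K : ℕ) :
    τ.toFun (cfc (fun x ↦ ∑ k ∈ Finset.range K,
      (φ (l k) - φ (l (k + 1))) * levelCutoff (l k / 4) x ^ 2) A) ≤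
      ENNReal.ofReal (4 / 3) * ∫⁻ u in Ioi 0, ENNReal.ofReal (φ (8 * τ.singularValue u A)) := by
  have hstep : ∀ k, 0 ≤ φ (l k) - φ (l (k + 1)) := fun k ↦
    sub_nonneg.2 (hφ (hl0 _).le (hl0 _).le (hl k.le_succ))
  rw [τ.toFun_cfc_sum _ hA (fun k ↦ by fun_prop) fun k x _ ↦ mul_nonneg (hstep k) (sq_nonneg _)]
  calc ∑ k ∈ Finset.range K,
        τ.toFun (cfc (fun x ↦ (φ (l k) - φ (l (k + 1))) * levelCutoff (l k / 4) x ^ 2) A)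
      ≤ ∑ k ∈ Finset.range K, ENNReal.ofReal (4 / 3) * ∫⁻ u in Ioi 0, ENNReal.ofReal
          ((φ (l k) - φ (l (k + 1))) * (Ici (l k)).indicator 1 (8 * τ.singularValue u A)) :=
        Finset.sum_le_sum fun k _ ↦
          τ.toFun_cfc_mul_levelCutoff_le_lintegral hA hsa (hstep k) (hl0 k)
    _ = ENNReal.ofReal (4 / 3) * ∫⁻ u in Ioi 0, ENNReal.ofReal (∑ k ∈ Finset.range K,
          (φ (l k) - φ (l (k + 1))) * (Ici (l k)).indicator 1 (8 * τ.singularValue u A)) := by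
        rw [← Finset.mul_sum, ← lintegral_finsetSum]
        · congr 1
          refine lintegral_congr fun u ↦ (ENNReal.ofReal_sum_of_nonneg fun k _ ↦ ?_).symm
          exact mul_nonneg (hstep k) (indicator_nonneg (fun _ _ ↦ zero_le_one) _)
        · have := τ.measurable_singularValue A
          exact fun k _ ↦ ((((measurable_const (a := (1 : ℝ))).indicator measurableSet_Ici).comp
            (this.const_mul 8)).const_mul _).ennreal_ofReal
    _ ≤ _ := by
        gcongr with u
        exact sum_sub_mul_indicator_le hφ (fun k ↦ (hl0 k).le) hφ0
          (mul_nonneg (by norm_num) (τ.singularValue_nonneg u A)) K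

theorem toFun_cfc_le_lintegral_singularValue (hA : A ∈ N) (h0 : 0 ≤ A)
    (hcont : ContinuousOn φ (Ici 0)) (hφ : MonotoneOn φ (Ici 0)) (hφ0 : φ 0 = 0) :
    τ.toFun (cfc φ A) ≤
      ENNReal.ofReal (4 / 3) * ∫⁻ u in Ioi 0, ENNReal.ofReal (φ (8 * τ.singularValue u A)) := by
  have hsp : ∀ x ∈ spectrum ℝ A, 0 ≤ x := fun x hx ↦ spectrum_nonneg_of_nonneg h0 hx
  have hφA : ContinuousOn φ (spectrum ℝ A) := hcont.mono hsp
  let l : ℕ → ℝ := fun k ↦ (‖A‖ + 1) / 2 ^ k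
  have hl0 : ∀ k, 0 < l k := fun k ↦ by positivity
  have hl_succ : ∀ k, 2 * (l k / 4) = l (k + 1) := fun k ↦ by
    simp only [l, pow_succ]
    ring
  have hl : Antitone l := antitone_nat_of_succ_le fun k ↦ by linarith [hl_succ k, hl0 k]
  have hl_lim : Filter.Tendsto l Filter.atTop (nhdsWithin 0 (Ici 0)) := by
    refine tendsto_nhdsWithin_iff.2 ⟨?_, Filter.Eventually.of_forall fun k ↦ (hl0 k).le⟩
    exact tendsto_const_nhds.div_atTop (tendsto_pow_atTop_atTop_of_one_lt one_lt_two)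
  refine τ.toFun_cfc_le_of_forall_pos hA h0.isSelfAdjoint hφA
    (fun x hx ↦ hφ0 ▸ hφ self_mem_Ici (hsp x hx) (hsp x hx)) fun ε hε ↦ ?_
  obtain ⟨K, hK⟩ : ∃ K, φ (l K) ≤ ε :=
    (((hcont 0 self_mem_Ici).tendsto.comp hl_lim).eventually_le_const (hφ0.trans_lt hε)).exists
  refine (τ.toFun_cfc_mono hA (by fun_prop) (by fun_prop) (fun x _ ↦ le_max_right _ _)
    fun x hx ↦ ?_).trans (τ.toFun_cfc_sum_levelCutoff_le_lintegral hA h0.isSelfAdjoint hφ hφ0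
      hl hl0 K)
  have hxl : x ≤ l 0 := by
    simp only [l, pow_zero, div_one]
    linarith [le_norm_of_mem_spectrum_real hx]
  have hlayers := le_add_sum_sub_mul hφ (fun k ↦ (hl0 k).le) hl
    (w := fun k ↦ levelCutoff (l k / 4) x ^ 2) (fun k ↦ sq_nonneg _) (hsp x hx) hxl (fun k hk ↦ by
      rw [levelCutoff_eq_one (by linarith [hl0 k]) ((hl_succ k).trans_le hk), one_pow]) K
  refine max_le (by linarith) (Finset.sum_nonneg fun k _ ↦ mul_nonneg ?_ (sq_nonneg _))
  exact sub_nonneg.2 (hφ (hl0 _).le (hl0 _).le (hl k.le_succ))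

end FNSTrace

theorem lintegral_Ioi_rpow_of_lt {a c : ℝ} (ha : a < -1) (hc : 0 < c) :
    ∫⁻ u in Ioi c, ENNReal.ofReal (u ^ a) = ENNReal.ofReal (-c ^ (a + 1) / (a + 1)) := by
  rw [← integral_Ioi_rpow_of_lt ha hc, ofReal_integral_eq_lintegral_ofReal
    (integrableOn_Ioi_rpow_of_lt ha hc)]
  filter_upwards [ae_restrict_mem measurableSet_Ioi] with u hu
  exact Real.rpow_nonneg (hc.trans hu).le a

theorem setLIntegral_Ioc_ofReal_min_inv_sq_le {r : ℝ} (hr : 0 ≤ r) (z : ℝ) :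
    ∫⁻ s in Ioc 0 r, ENNReal.ofReal (min (s ^ 2)⁻¹ (z ^ 2)) ≤ ENNReal.ofReal (r * z ^ 2) :=
  calc ∫⁻ s in Ioc 0 r, ENNReal.ofReal (min (s ^ 2)⁻¹ (z ^ 2))
      ≤ ∫⁻ _ in Ioc 0 r, ENNReal.ofReal (z ^ 2) := by
        gcongr
        exact min_le_right _ _
    _ = ENNReal.ofReal (r * z ^ 2) := by
        rw [setLIntegral_const, Real.volume_Ioc, sub_zero, mul_comm, ENNReal.ofReal_mul hr]

theorem lintegral_Ioi_inv_ofReal_min_inv_sq_le {z : ℝ} (hz : 0 < z) :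
    ∫⁻ s in Ioi z⁻¹, ENNReal.ofReal (min (s ^ 2)⁻¹ (z ^ 2)) ≤ ENNReal.ofReal z :=
  calc ∫⁻ s in Ioi z⁻¹, ENNReal.ofReal (min (s ^ 2)⁻¹ (z ^ 2))
      ≤ ∫⁻ s in Ioi z⁻¹, ENNReal.ofReal (s ^ (-2 : ℝ)) := by
        refine setLIntegral_mono (by fun_prop) fun s hs ↦ ENNReal.ofReal_le_ofReal ?_
        rw [Real.rpow_neg ((inv_pos.2 hz).trans hs).le, Real.rpow_two]
        exact min_le_left _ _
    _ = ENNReal.ofReal z := by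
        rw [lintegral_Ioi_rpow_of_lt (by norm_num) (inv_pos.2 hz),
          show (-2 : ℝ) + 1 = -1 by norm_num, Real.rpow_neg_one, inv_inv, neg_div_neg_eq, div_one]

theorem setLIntegral_ofReal_min_inv_sq_le {z t : ℝ} (hz : 0 ≤ z) (ht : 0 ≤ t) :
    ∫⁻ s in Ioc 0 t, ENNReal.ofReal (min (s ^ 2)⁻¹ (z ^ 2)) ≤
      ENNReal.ofReal (min (2 * z) (t * z ^ 2)) := by
  rcases hz.eq_or_lt with rfl | hz
  · simp
  rw [ENNReal.ofReal_min]
  refine le_min ?_ (setLIntegral_Ioc_ofReal_min_inv_sq_le ht z)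
  calc ∫⁻ s in Ioc 0 t, ENNReal.ofReal (min (s ^ 2)⁻¹ (z ^ 2))
      ≤ ∫⁻ s in Ioc 0 z⁻¹ ∪ Ioi z⁻¹, ENNReal.ofReal (min (s ^ 2)⁻¹ (z ^ 2)) := by
        rw [Ioc_union_Ioi_eq_Ioi (inv_nonneg.2 hz.le)]
        exact lintegral_mono_set Ioc_subset_Ioi_self
    _ ≤ ENNReal.ofReal (z⁻¹ * z ^ 2) + ENNReal.ofReal z :=
        (lintegral_union_le _ _ _).trans (add_le_add
          (setLIntegral_Ioc_ofReal_min_inv_sq_le (inv_nonneg.2 hz.le) z)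
          (lintegral_Ioi_inv_ofReal_min_inv_sq_le hz))
    _ = ENNReal.ofReal (2 * z) := by
        rw [← ENNReal.ofReal_add (by positivity) hz.le]
        congr 1
        field_simp
        norm_num

section LogarithmicGrowth

variable {y : ℝ → ℝ} {C : ℝ} (hy : Antitone y) (hy0 : ∀ u, 0 ≤ y u)
  (hC : ∀ t, 0 < t → ∫ u in (0 : ℝ)..t, y u ≤ C * Real.log (1 + t))

include hy hC

theorem mul_le_mul_log_of_integral_le {t : ℝ} (ht : 0 < t) : t * y t ≤ C * Real.log (1 + t) :=
  calc t * y t = ∫ _ in (0 : ℝ)..t, y t := by simp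
    _ ≤ ∫ u in (0 : ℝ)..t, y u :=
      intervalIntegral.integral_mono_on ht.le intervalIntegrable_const hy.intervalIntegrable
        fun _ hu ↦ hy hu.2
    _ ≤ C * Real.log (1 + t) := hC t ht

include hy0

theorem nonneg_of_integral_le_mul_log : 0 ≤ C := by
  have := (mul_nonneg zero_le_one (hy0 1)).trans (mul_le_mul_log_of_integral_le hy hC one_pos)
  exact nonneg_of_mul_nonneg_left this (Real.log_pos (by norm_num))

theorem sq_le_mul_rpow_of_integral_le {t : ℝ} (ht : 1 ≤ t) :
    y t ^ 2 ≤ 32 * C ^ 2 * t ^ (-(3 / 2) : ℝ) := by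
  have ht0 : 0 < t := one_pos.trans_le ht
  have hlog : Real.log (1 + t) ^ 2 ≤ 32 * t ^ (1 / 2 : ℝ) := by
    calc Real.log (1 + t) ^ 2 ≤ ((1 + t) ^ (1 / 4 : ℝ) / (1 / 4)) ^ 2 :=
          pow_le_pow_left₀ (Real.log_nonneg (by linarith))
            (Real.log_le_rpow_div (by linarith) (by norm_num)) 2
      _ = 16 * (1 + t) ^ (1 / 2 : ℝ) := by
          rw [div_pow, ← Real.rpow_mul_natCast (by linarith)]
          norm_num
          ring
      _ ≤ 16 * (2 ^ 2 * t) ^ (1 / 2 : ℝ) := by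
          gcongr
          linarith
      _ = 32 * t ^ (1 / 2 : ℝ) := by
          rw [← Real.sqrt_eq_rpow, ← Real.sqrt_eq_rpow, Real.sqrt_mul (by positivity),
            Real.sqrt_sq two_pos.le]
          ring
  have hsq : (t * y t) ^ 2 ≤ C ^ 2 * (32 * t ^ (1 / 2 : ℝ)) :=
    calc (t * y t) ^ 2 ≤ (C * Real.log (1 + t)) ^ 2 :=
          pow_le_pow_left₀ (mul_nonneg ht0.le (hy0 t)) (mul_le_mul_log_of_integral_le hy hC ht0) 2
      _ ≤ C ^ 2 * (32 * t ^ (1 / 2 : ℝ)) := by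
          rw [mul_pow]
          gcongr
  rw [show (-(3 / 2) : ℝ) = 1 / 2 - 2 by norm_num, Real.rpow_sub ht0, Real.rpow_two, mul_div_assoc',
    le_div_iff₀ (by positivity)]
  linarith

theorem setLIntegral_Ioi_sq_le {T : ℝ} (hT : 1 ≤ T) :
    ∫⁻ u in Ioi T, ENNReal.ofReal (y u ^ 2) ≤ ENNReal.ofReal (64 * C ^ 2 / √T) :=
  calc ∫⁻ u in Ioi T, ENNReal.ofReal (y u ^ 2)
      ≤ ∫⁻ u in Ioi T, ENNReal.ofReal (32 * C ^ 2) * ENNReal.ofReal (u ^ (-(3 / 2) : ℝ)) := by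
        refine setLIntegral_mono (by fun_prop) fun u hu ↦ ?_
        rw [← ENNReal.ofReal_mul (by positivity)]
        exact ENNReal.ofReal_le_ofReal
          (sq_le_mul_rpow_of_integral_le hy hy0 hC (hT.trans (mem_Ioi.1 hu).le))
    _ = ENNReal.ofReal (64 * C ^ 2 / √T) := by
        rw [lintegral_const_mul _ (by fun_prop),
          lintegral_Ioi_rpow_of_lt (by norm_num) (by linarith),
          ← ENNReal.ofReal_mul (by positivity), show -(3 / 2) + 1 = -(1 / 2 : ℝ) by norm_num,
          Real.rpow_neg (by linarith), ← Real.sqrt_eq_rpow]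
        congr 1
        ring

theorem lintegral_sq_lt_top_of_integral_le : ∫⁻ u in Ioi 0, ENNReal.ofReal (y u ^ 2) < ∞ := by
  rw [← Ioc_union_Ioi_eq_Ioi (zero_le_one (α := ℝ))]
  refine (lintegral_union_le _ _ _).trans_lt (ENNReal.add_lt_top.2 ⟨?_, ?_⟩)
  · refine (setLIntegral_mono measurable_const fun u hu ↦ ENNReal.ofReal_le_ofReal
      (pow_le_pow_left₀ (hy0 u) (hy (mem_Ioc.1 hu).1.le) 2)).trans_lt ?_
    rw [setLIntegral_const, Real.volume_Ioc]
    exact ENNReal.mul_lt_top ENNReal.ofReal_lt_top ENNReal.ofReal_lt_top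
  · exact (setLIntegral_Ioi_sq_le hy hy0 hC le_rfl).trans_lt ENNReal.ofReal_lt_top

theorem setLIntegral_Ioc_le_of_integral_le {T : ℝ} (hT : 0 < T) :
    ∫⁻ u in Ioc 0 T, ENNReal.ofReal (y u) ≤ ENNReal.ofReal (C * Real.log (1 + T)) := by
  rw [← ofReal_integral_eq_lintegral_ofReal
    ((intervalIntegrable_iff_integrableOn_Ioc_of_le hT.le).1 hy.intervalIntegrable)
    (Filter.Eventually.of_forall hy0), ← intervalIntegral.integral_of_le hT.le]
  exact ENNReal.ofReal_le_ofReal (hC T hT)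

theorem lintegral_min_mul_sq_le {t : ℝ} (ht : 2 ≤ t) :
    ∫⁻ u in Ioi 0, ENNReal.ofReal (min (2 * y u) (t * y u ^ 2)) ≤
      ENNReal.ofReal ((6 * C + 128 * C ^ 2) * Real.log t) := by
  have ht0 : 0 < t := two_pos.trans_le ht
  have hC0 : 0 ≤ C := nonneg_of_integral_le_mul_log hy hy0 hC
  have hlog : 1 / 2 ≤ Real.log t :=
    le_trans (by linarith [Real.log_two_gt_d9]) (Real.log_le_log two_pos ht)
  have hlog_sq : Real.log (1 + t ^ 2) ≤ 3 * Real.log t := by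
    rw [show 3 * Real.log t = Real.log (t ^ 3) by rw [Real.log_pow, Nat.cast_ofNat]]
    exact Real.log_le_log (by positivity) (by nlinarith)
  have hhead : ∫⁻ u in Ioc 0 (t ^ 2), ENNReal.ofReal (2 * y u) ≤
      ENNReal.ofReal (6 * C * Real.log t) := by
    simp only [ENNReal.ofReal_mul (zero_le_two (α := ℝ))]
    rw [lintegral_const_mul _ hy.measurable.ennreal_ofReal]
    refine (mul_le_mul_right (setLIntegral_Ioc_le_of_integral_le hy hy0 hC (by positivity)) _).trans
      ?_
    rw [← ENNReal.ofReal_mul zero_le_two]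
    exact ENNReal.ofReal_le_ofReal (by linarith [mul_le_mul_of_nonneg_left hlog_sq hC0])
  have htail : ∫⁻ u in Ioi (t ^ 2), ENNReal.ofReal (t * y u ^ 2) ≤
      ENNReal.ofReal (128 * C ^ 2 * Real.log t) := by
    simp only [ENNReal.ofReal_mul ht0.le]
    rw [lintegral_const_mul _ (hy.measurable.pow_const 2).ennreal_ofReal]
    refine (mul_le_mul_right (setLIntegral_Ioi_sq_le hy hy0 hC (by nlinarith)) _).trans ?_
    rw [← ENNReal.ofReal_mul ht0.le, Real.sqrt_sq ht0.le, mul_div_cancel₀ _ ht0.ne']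
    exact ENNReal.ofReal_le_ofReal (by nlinarith [mul_nonneg (sq_nonneg C) (sub_nonneg.2 hlog)])
  rw [← Ioc_union_Ioi_eq_Ioi (sq_nonneg t), add_mul,
    ENNReal.ofReal_add (by positivity) (by positivity)]
  refine (lintegral_union_le _ _ _).trans (add_le_add (le_trans ?_ hhead) (le_trans ?_ htail)) <;>
    gcongr
  exacts [min_le_left _ _, min_le_right _ _]

theorem lintegral_lintegral_min_inv_sq_le {t : ℝ} (ht : 2 ≤ t) :
    ∫⁻ s in Ioc 1 t, ∫⁻ u in Ioi 0, ENNReal.ofReal (min (s ^ 2)⁻¹ (y u ^ 2)) ≤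
      ENNReal.ofReal ((6 * C + 128 * C ^ 2) * Real.log t) := by
  have hy_meas := hy.measurable
  calc ∫⁻ s in Ioc 1 t, ∫⁻ u in Ioi 0, ENNReal.ofReal (min (s ^ 2)⁻¹ (y u ^ 2))
      ≤ ∫⁻ s in Ioc 0 t, ∫⁻ u in Ioi 0, ENNReal.ofReal (min (s ^ 2)⁻¹ (y u ^ 2)) :=
        lintegral_mono_set (Ioc_subset_Ioc_left zero_le_one)
    _ = ∫⁻ u in Ioi 0, ∫⁻ s in Ioc 0 t, ENNReal.ofReal (min (s ^ 2)⁻¹ (y u ^ 2)) :=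
        lintegral_lintegral_swap (Measurable.aemeasurable (by fun_prop))
    _ ≤ ∫⁻ u in Ioi 0, ENNReal.ofReal (min (2 * y u) (t * y u ^ 2)) :=
        lintegral_mono fun u ↦ setLIntegral_ofReal_min_inv_sq_le (hy0 u) (by linarith)
    _ ≤ ENNReal.ofReal ((6 * C + 128 * C ^ 2) * Real.log t) :=
        lintegral_min_mul_sq_le hy hy0 hC ht

end LogarithmicGrowth

namespace FNSTrace

variable {H : Type*} [NormedAddCommGroup H] [InnerProductSpace ℂ H] [CompleteSpace H]
  {N : VonNeumannAlgebra H} (τ : FNSTrace N) {A B : H →L[ℂ] H}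

theorem exists_integral_singularValue_le (hA : A ∈ τ.M1Infty) :
    ∃ C, ∀ t, 0 < t → ∫ u in (0 : ℝ)..t, τ.singularValue u A ≤ C * Real.log (1 + t) := by
  obtain ⟨C, hC⟩ := hA.2
  refine ⟨C, fun t ht ↦ ?_⟩
  have := hC (mem_image_of_mem _ (mem_Ioi.2 ht))
  rwa [one_div_mul_eq_div, div_le_iff₀ (Real.log_pos (by linarith))] at this

theorem exists_integral_eight_mul_singularValue_le (hA : A ∈ τ.M1Infty) :
    ∃ C, ∀ t, 0 < t → ∫ u in (0 : ℝ)..t, 8 * τ.singularValue u A ≤ C * Real.log (1 + t) := by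
  obtain ⟨C, hC⟩ := τ.exists_integral_singularValue_le hA
  refine ⟨8 * C, fun t ht ↦ ?_⟩
  rw [intervalIntegral.integral_const_mul, mul_assoc]
  exact mul_le_mul_of_nonneg_left (hC t ht) (by norm_num)

theorem antitone_eight_mul_singularValue (A : H →L[ℂ] H) :
    Antitone fun u ↦ 8 * τ.singularValue u A :=
  (τ.antitone_singularValue A).const_mul (by norm_num)

theorem eight_mul_singularValue_nonneg (A : H →L[ℂ] H) (u : ℝ) : 0 ≤ 8 * τ.singularValue u A :=
  mul_nonneg (by norm_num) (τ.singularValue_nonneg u A)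

theorem toFun_cfc_sq_lt_top (hA : A ∈ τ.M1Infty) (h0 : 0 ≤ A) :
    τ.toFun (cfc (fun x : ℝ ↦ x ^ 2) A) < ∞ := by
  obtain ⟨C, hC⟩ := τ.exists_integral_eight_mul_singularValue_le hA
  refine (τ.toFun_cfc_le_lintegral_singularValue hA.1 h0 (by fun_prop)
    (fun _ hx _ _ hxy ↦ pow_le_pow_left₀ hx hxy 2) (by norm_num)).trans_lt
    (ENNReal.mul_lt_top ENNReal.ofReal_lt_top ?_)
  exact lintegral_sq_lt_top_of_integral_le (τ.antitone_eight_mul_singularValue A)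
    (τ.eight_mul_singularValue_nonneg A) hC

theorem exists_lintegral_toFun_cfc_min_le (hA : A ∈ τ.M1Infty) (h0 : 0 ≤ A) :
    ∃ K : ℝ, ∀ t, 2 ≤ t →
      ∫⁻ s in Ioc 1 t, τ.toFun (cfc (fun x ↦ min (s ^ 2)⁻¹ (x ^ 2)) A) ≤
        ENNReal.ofReal (K * Real.log t) := by
  obtain ⟨C, hC⟩ := τ.exists_integral_eight_mul_singularValue_le hA
  refine ⟨4 / 3 * (6 * C + 128 * C ^ 2), fun t ht ↦ ?_⟩
  calc ∫⁻ s in Ioc 1 t, τ.toFun (cfc (fun x ↦ min (s ^ 2)⁻¹ (x ^ 2)) A)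
      ≤ ∫⁻ s in Ioc 1 t, ENNReal.ofReal (4 / 3) *
          ∫⁻ u in Ioi 0, ENNReal.ofReal (min (s ^ 2)⁻¹ ((8 * τ.singularValue u A) ^ 2)) :=
        lintegral_mono fun s ↦ τ.toFun_cfc_le_lintegral_singularValue hA.1 h0 (by fun_prop)
          (fun _ hx _ _ hxy ↦ min_le_min_left _ (pow_le_pow_left₀ hx hxy 2))
          (by rw [zero_pow two_ne_zero, min_eq_right (by positivity)])
    _ ≤ ENNReal.ofReal (4 / 3) * ENNReal.ofReal ((6 * C + 128 * C ^ 2) * Real.log t) := by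
        rw [lintegral_const_mul' _ _ ENNReal.ofReal_ne_top]
        exact mul_le_mul_right (lintegral_lintegral_min_inv_sq_le
          (τ.antitone_eight_mul_singularValue A) (τ.eight_mul_singularValue_nonneg A) hC ht) _
    _ = ENNReal.ofReal (4 / 3 * (6 * C + 128 * C ^ 2) * Real.log t) := by
        rw [← ENNReal.ofReal_mul (by norm_num), mul_assoc]

section HeatFunction

variable {f : ℝ → ℂ} (hf : ContinuousOn f (Ici 0))

include hf

theorem continuousOn_comp_mul_spectrum (h0 : 0 ≤ A) {s : ℝ} (hs : 0 ≤ s) :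
    ContinuousOn (fun x ↦ f (s * x)) (spectrum ℝ A) :=
  hf.comp (by fun_prop) fun _ hx ↦ mul_nonneg hs (spectrum_nonneg_of_nonneg h0 hx)

theorem opFun_smul_of_nonneg (h0 : 0 ≤ A) {s : ℝ} (hs : 0 ≤ s) :
    opFun f ((s : ℂ) • A) = opFun (fun x ↦ f (s * x)) A := by
  refine opFun_smul h0.isSelfAdjoint s (hf.mono ?_)
  rintro _ ⟨x, hx, rfl⟩
  exact mul_nonneg hs (spectrum_nonneg_of_nonneg h0 hx)

theorem heatFun_div (hA : A ∈ N) (h0 : 0 ≤ A) (hB : B ∈ N) {s : ℝ} (hs : 0 < s) :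
    heatFun τ f A B s / (s : ℂ) =
      τ.tr (opFun (fun x ↦ (((s ^ 2)⁻¹ : ℝ) : ℂ) * f (s * x)) A * B) := by
  rw [opFun_real_const_mul h0.isSelfAdjoint _ (continuousOn_comp_mul_spectrum hf h0 hs.le),
    smul_mul_assoc, τ.tr_real_smul (by positivity) (mul_mem (opFun_mem _ hA) hB), heatFun,
    opFun_smul_of_nonneg hf h0 hs.le]
  push_cast
  field_simp

variable {C : ℝ} (hfC : ∀ x, 0 ≤ x → ‖f x‖ ≤ C * min 1 (x ^ 2))

include hfC

omit hf in
theorem nonneg_of_norm_le_mul_min : 0 ≤ C := by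
  simpa using (norm_nonneg _).trans (hfC 1 zero_le_one)

omit hf in
theorem norm_inv_sq_mul_le {s x : ℝ} (hs : 0 < s) (hx : 0 ≤ x) :
    ‖(((s ^ 2)⁻¹ : ℝ) : ℂ) * f (s * x)‖ ≤ C * min (s ^ 2)⁻¹ (x ^ 2) := by
  have hs2 : 0 ≤ (s ^ 2)⁻¹ := by positivity
  calc ‖(((s ^ 2)⁻¹ : ℝ) : ℂ) * f (s * x)‖ = (s ^ 2)⁻¹ * ‖f (s * x)‖ := by
        rw [norm_mul, Complex.norm_real, Real.norm_of_nonneg hs2]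
    _ ≤ (s ^ 2)⁻¹ * (C * min 1 ((s * x) ^ 2)) :=
        mul_le_mul_of_nonneg_left (hfC _ (mul_nonneg hs.le hx)) hs2
    _ = C * min (s ^ 2)⁻¹ (x ^ 2) := by
        rw [mul_left_comm, mul_min_of_nonneg _ _ hs2, mul_one, mul_pow,
          inv_mul_cancel_left₀ (by positivity)]

theorem opFun_smul_mul_mem_L1 (hA : A ∈ τ.M1Infty) (h0 : 0 ≤ A) (hB : B ∈ N) {t : ℝ} (ht : 0 < t) :
    opFun f ((t : ℂ) • A) * B ∈ τ.L1 := by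
  have hcont := continuousOn_comp_mul_spectrum hf h0 ht.le
  have hC0 : 0 ≤ C := nonneg_of_norm_le_mul_min hfC
  rw [opFun_smul_of_nonneg hf h0 ht.le]
  refine (τ.opFun_mul_mem_L1 hA.1 h0.isSelfAdjoint hB hcont ?_).1
  calc τ.toFun (cfc (fun x ↦ ‖f (t * x)‖) A)
      ≤ τ.toFun (cfc (fun x ↦ C * t ^ 2 * x ^ 2) A) := by
        refine τ.toFun_cfc_mono hA.1 hcont.norm (by fun_prop) (fun _ _ ↦ norm_nonneg _)
          fun x hx ↦ (hfC _ (mul_nonneg ht.le (spectrum_nonneg_of_nonneg h0 hx))).trans ?_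
        rw [mul_assoc, ← mul_pow]
        exact mul_le_mul_of_nonneg_left (min_le_right _ _) hC0
    _ = ENNReal.ofReal (C * t ^ 2) * τ.toFun (cfc (fun x ↦ x ^ 2) A) :=
        τ.toFun_cfc_const_mul hA.1 (by positivity) (by fun_prop) fun x _ ↦ sq_nonneg x
    _ < ∞ := ENNReal.mul_lt_top ENNReal.ofReal_lt_top (τ.toFun_cfc_sq_lt_top hA h0)

theorem continuousOn_heatFun_div (hA : A ∈ τ.M1Infty) (h0 : 0 ≤ A) (hB : B ∈ N) :
    ContinuousOn (fun s : ℝ ↦ heatFun τ f A B s / (s : ℂ)) (Ioi 0) := by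
  have hsp : ∀ x ∈ spectrum ℝ A, 0 ≤ x := fun x hx ↦ spectrum_nonneg_of_nonneg h0 hx
  have hC0 : 0 ≤ C := nonneg_of_norm_le_mul_min hfC
  refine (τ.continuousOn_tr_opFun_mul (g := fun s x ↦ (((s ^ 2)⁻¹ : ℝ) : ℂ) * f (s * x))
    (φ := fun x ↦ C * x ^ 2) hA.1 h0.isSelfAdjoint hB ?_ (by fun_prop) ?_ fun s hs x hx ↦ ?_).congr
    fun s hs ↦ τ.heatFun_div hf hA.1 h0 hB hs
  · refine ContinuousOn.mul (f := fun p : ℝ × ℝ ↦ (((p.1 ^ 2)⁻¹ : ℝ) : ℂ))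
      (Complex.continuous_ofReal.comp_continuousOn (ContinuousOn.inv₀ (by fun_prop) fun p hp ↦
        pow_ne_zero 2 (ne_of_gt hp.1))) ?_
    exact hf.comp (by fun_prop) fun p hp ↦ mul_nonneg (mem_Ioi.1 hp.1).le (hsp _ hp.2)
  · rw [τ.toFun_cfc_const_mul hA.1 hC0 (by fun_prop) fun x _ ↦ sq_nonneg x]
    exact ENNReal.mul_lt_top ENNReal.ofReal_lt_top (τ.toFun_cfc_sq_lt_top hA h0)
  · exact (norm_inv_sq_mul_le hfC hs (hsp x hx)).trans
      (mul_le_mul_of_nonneg_left (min_le_right _ _) hC0)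

theorem enorm_heatFun_div_le (hA : A ∈ N) (h0 : 0 ≤ A) (hB : B ∈ N) {s : ℝ} (hs : 0 < s) :
    ‖heatFun τ f A B s / (s : ℂ)‖ₑ ≤ ENNReal.ofReal ((1 + ‖B‖ ^ 2) * C) *
      τ.toFun (cfc (fun x ↦ min (s ^ 2)⁻¹ (x ^ 2)) A) := by
  have hC0 : 0 ≤ C := nonneg_of_norm_le_mul_min hfC
  have hmin : ContinuousOn (fun x ↦ min (s ^ 2)⁻¹ (x ^ 2)) (spectrum ℝ A) := by fun_prop
  rw [τ.heatFun_div hf hA h0 hB hs, ENNReal.ofReal_mul (by positivity), mul_assoc,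
    ← τ.toFun_cfc_const_mul hA hC0 hmin fun x _ ↦ by positivity]
  exact τ.enorm_tr_opFun_mul_le hA h0.isSelfAdjoint hB
    (continuousOn_const.mul (continuousOn_comp_mul_spectrum hf h0 hs.le)) (hmin.const_mul C)
    fun x hx ↦ norm_inv_sq_mul_le hfC hs (spectrum_nonneg_of_nonneg h0 hx)

theorem exists_norm_heatFun_div_le (hA : A ∈ τ.M1Infty) (h0 : 0 ≤ A) (hB : B ∈ N) :
    ∃ K, ∀ s, 0 < s → ‖heatFun τ f A B s / (s : ℂ)‖ ≤ K := by
  have hle : ∀ s, 0 < s → ‖heatFun τ f A B s / (s : ℂ)‖ₑ ≤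
      ENNReal.ofReal ((1 + ‖B‖ ^ 2) * C) * τ.toFun (cfc (fun x : ℝ ↦ x ^ 2) A) := by
    intro s hs
    refine (τ.enorm_heatFun_div_le hf hfC hA.1 h0 hB hs).trans (mul_le_mul_right ?_ _)
    exact τ.toFun_cfc_mono hA.1 (by fun_prop) (by fun_prop) (fun x _ ↦ by positivity)
      fun x _ ↦ min_le_right _ _
  have htop := ENNReal.mul_lt_top (ENNReal.ofReal_lt_top (r := (1 + ‖B‖ ^ 2) * C))
    (τ.toFun_cfc_sq_lt_top hA h0)
  refine ⟨_, fun s hs ↦ (ENNReal.ofReal_le_iff_le_toReal htop.ne).1 ?_⟩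
  rw [ofReal_norm]
  exact hle s hs

theorem exists_norm_integral_heatFun_div_le (hA : A ∈ τ.M1Infty) (h0 : 0 ≤ A) (hB : B ∈ N) :
    ∃ K, ∀ t, 2 ≤ t → ‖∫ s in (1 : ℝ)..t, heatFun τ f A B s / (s : ℂ)‖ ≤ K * Real.log t := by
  obtain ⟨K, hK⟩ := τ.exists_lintegral_toFun_cfc_min_le hA h0
  have hC0 : 0 ≤ C := nonneg_of_norm_le_mul_min hfC
  refine ⟨(1 + ‖B‖ ^ 2) * C * max K 0, fun t ht ↦ ?_⟩
  have hlog : 0 ≤ Real.log t := Real.log_nonneg (by linarith)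
  rw [intervalIntegral.integral_of_le (by linarith), ← ENNReal.ofReal_le_ofReal_iff (by positivity),
    ofReal_norm]
  calc ‖∫ s in Ioc 1 t, heatFun τ f A B s / (s : ℂ)‖ₑ
      ≤ ∫⁻ s in Ioc 1 t, ‖heatFun τ f A B s / (s : ℂ)‖ₑ := enorm_integral_le_lintegral_enorm _
    _ ≤ ∫⁻ s in Ioc 1 t, ENNReal.ofReal ((1 + ‖B‖ ^ 2) * C) *
          τ.toFun (cfc (fun x ↦ min (s ^ 2)⁻¹ (x ^ 2)) A) :=
        setLIntegral_mono' measurableSet_Ioc fun s hs ↦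
          τ.enorm_heatFun_div_le hf hfC hA.1 h0 hB (one_pos.trans hs.1)
    _ ≤ ENNReal.ofReal ((1 + ‖B‖ ^ 2) * C) * ENNReal.ofReal (max K 0 * Real.log t) := by
        rw [lintegral_const_mul' _ _ ENNReal.ofReal_ne_top]
        refine mul_le_mul_right ((hK t ht).trans (ENNReal.ofReal_le_ofReal ?_)) _
        exact mul_le_mul_of_nonneg_right (le_max_left _ _) hlog
    _ = ENNReal.ofReal ((1 + ‖B‖ ^ 2) * C * max K 0 * Real.log t) := by
        rw [← ENNReal.ofReal_mul (by positivity), mul_assoc ((1 + ‖B‖ ^ 2) * C)]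

end HeatFunction

end FNSTrace

theorem abs_sub_one_le_two_mul_abs_log {t : ℝ} (ht : 0 < t) (ht2 : t ≤ 2) :
    |t - 1| ≤ 2 * |Real.log t| := by
  rcases le_total t 1 with h | h
  · rw [abs_of_nonpos (sub_nonpos.2 h), abs_of_nonpos (Real.log_nonpos ht.le h)]
    linarith [Real.log_le_sub_one_of_pos ht]
  · rw [abs_of_nonneg (sub_nonneg.2 h), abs_of_nonneg (Real.log_nonneg h)]
    have hle : t - 1 ≤ 2 * (1 - t⁻¹) := by
      rw [show 1 - t⁻¹ = (t - 1) / t by field_simp, mul_div_assoc', le_div_iff₀ ht, mul_comm]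
      exact mul_le_mul_of_nonneg_right ht2 (sub_nonneg.2 h)
    linarith [Real.one_sub_inv_le_log_of_pos ht]

theorem uIcc_one_subset_Ioi {t : ℝ} (ht : 0 < t) : uIcc 1 t ⊆ Ioi 0 :=
  fun _ hs ↦ (lt_min one_pos ht).trans_le hs.1

section Cesaro

variable {x : ℝ → ℂ} (hx : ContinuousOn (fun s : ℝ ↦ x s / (s : ℂ)) (Ioi 0))

include hx

theorem cesaroDomain_of_continuousOn : CesaroDomain x :=
  fun _ ht ↦ (hx.mono (uIcc_one_subset_Ioi ht)).intervalIntegrable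

theorem aestronglyMeasurable_cesaro :
    AEStronglyMeasurable (cesaro x) (volume.restrict (Ioi 0)) := by
  have hprimitive : ContinuousOn (fun t : ℝ ↦ ∫ s in (1 : ℝ)..t, x s / (s : ℂ)) (Ioi 0) :=
    fun t ht ↦ (intervalIntegral.integral_hasDerivAt_right (cesaroDomain_of_continuousOn hx t ht)
      (hx.stronglyMeasurableAtFilter isOpen_Ioi t ht)
      (hx.continuousAt (Ioi_mem_nhds ht))).continuousAt.continuousWithinAt
  exact (Measurable.aestronglyMeasurable (by fun_prop)).mul
    (hprimitive.aestronglyMeasurable measurableSet_Ioi)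

theorem cesaro_mem_LInfty {K₁ K₂ : ℝ} (h_le : ∀ s, 0 < s → ‖x s / (s : ℂ)‖ ≤ K₁)
    (h_int : ∀ t, 2 ≤ t → ‖∫ s in (1 : ℝ)..t, x s / (s : ℂ)‖ ≤ K₂ * Real.log t) :
    cesaro x ∈ LInfty := by
  have hK₁ : 0 ≤ K₁ := (norm_nonneg _).trans (h_le 1 one_pos)
  have hlog : ∀ t, 0 < t →
      ‖∫ s in (1 : ℝ)..t, x s / (s : ℂ)‖ ≤ max (2 * K₁) K₂ * |Real.log t| := by
    intro t ht
    rcases le_total t 2 with ht2 | ht2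
    · calc ‖∫ s in (1 : ℝ)..t, x s / (s : ℂ)‖ ≤ K₁ * |t - 1| :=
            intervalIntegral.norm_integral_le_of_norm_le_const fun s hs ↦
              h_le s (uIcc_one_subset_Ioi ht (uIoc_subset_uIcc hs))
        _ ≤ K₁ * (2 * |Real.log t|) :=
            mul_le_mul_of_nonneg_left (abs_sub_one_le_two_mul_abs_log ht ht2) hK₁
        _ = 2 * K₁ * |Real.log t| := by ring
        _ ≤ _ := mul_le_mul_of_nonneg_right (le_max_left _ _) (abs_nonneg _)
    · refine (h_int t ht2).trans ?_
      rw [abs_of_nonneg (Real.log_nonneg (by linarith))]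
      exact mul_le_mul_of_nonneg_right (le_max_right _ _) (Real.log_nonneg (by linarith))
  refine ⟨aestronglyMeasurable_cesaro hx, max (2 * K₁) K₂, fun t ht ↦ ?_⟩
  rw [cesaro, norm_mul, norm_div, norm_one, Complex.norm_real, Real.norm_eq_abs,
    one_div_mul_eq_div]
  exact div_le_of_le_mul₀ (abs_nonneg _) (le_max_of_le_left (by positivity)) (hlog t ht)

end Cesaro

theorem exists_norm_le_mul_min {E : Type*} [NormedAddCommGroup E] [NormedSpace ℝ E] {f : ℝ → E}
    (hf : ContDiffOn ℝ 2 f (Ici 0)) (hbdd : ∃ K : ℝ, ∀ t : ℝ, 0 ≤ t → ‖f t‖ ≤ K) (hf0 : f 0 = 0)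
    (hf'0 : derivWithin f (Ici 0) 0 = 0) :
    ∃ C : ℝ, ∀ x : ℝ, 0 ≤ x → ‖f x‖ ≤ C * min 1 (x ^ 2) := by
  obtain ⟨K, hK⟩ := hbdd
  obtain ⟨C, hC⟩ := exists_taylor_mean_remainder_bound (f := f) (n := 1)
    (zero_le_one (α := ℝ)) (by exact_mod_cast hf.mono Icc_subset_Ici_self)
  have hderiv : derivWithin f (Icc 0 1) 0 = 0 := by
    rw [derivWithin_subset Icc_subset_Ici_self (uniqueDiffOn_Icc one_pos 0 (by simp))
      (hf.differentiableOn (by norm_num) 0 self_mem_Ici), hf'0]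
  have htaylor : ∀ x ∈ Icc (0 : ℝ) 1, ‖f x‖ ≤ C * x ^ 2 := by
    intro x hx
    simpa [taylorWithinEval_succ, iteratedDerivWithin_one, hf0, hderiv] using hC x hx
  refine ⟨max C K, fun x hx ↦ ?_⟩
  rcases le_total x 1 with h1 | h1
  · rw [min_eq_right (pow_le_one₀ hx h1)]
    exact (htaylor x ⟨hx, h1⟩).trans (mul_le_mul_of_nonneg_right (le_max_left _ _) (sq_nonneg x))
  · rw [min_eq_left (one_le_pow₀ h1), mul_one]
    exact (hK x hx).trans (le_max_right _ _)

theorem mainTheorem10_general {H : Type*} [NormedAddCommGroup H] [InnerProductSpace ℂ H]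
    [CompleteSpace H] {N : VonNeumannAlgebra H} (τ : FNSTrace N) {f : ℝ → ℂ}
    (hf : ContinuousOn f (Ici 0)) (hfC : ∃ C : ℝ, ∀ x : ℝ, 0 ≤ x → ‖f x‖ ≤ C * min 1 (x ^ 2))
    {A B : H →L[ℂ] H} (hA : A ∈ τ.M1Infty) (hApos : 0 ≤ A) (hB : B ∈ N) :
    (∀ t : ℝ, 0 < t → opFun f ((t : ℂ) • A) * B ∈ τ.L1) ∧
      CesaroDomain (heatFun τ f A B) ∧
      cesaro (heatFun τ f A B) ∈ LInfty := by
  obtain ⟨C, hfC⟩ := hfC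
  have hcont := τ.continuousOn_heatFun_div hf hfC hA hApos hB
  obtain ⟨K₁, hK₁⟩ := τ.exists_norm_heatFun_div_le hf hfC hA hApos hB
  obtain ⟨K₂, hK₂⟩ := τ.exists_norm_integral_heatFun_div_le hf hfC hA hApos hB
  exact ⟨fun t ht ↦ τ.opFun_smul_mul_mem_L1 hf hfC hA hApos hB ht,
    cesaroDomain_of_continuousOn hcont, cesaro_mem_LInfty hcont hK₁ hK₂⟩

theorem mainTheorem10 {H : Type*} [NormedAddCommGroup H] [InnerProductSpace ℂ H] [CompleteSpace H]
    (N : VonNeumannAlgebra H) (τ : FNSTrace N)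
    (f : ℝ → ℂ) (hf : ContDiffOn ℝ 2 f (Ici 0)) (hbdd : ∃ K : ℝ, ∀ t : ℝ, 0 ≤ t → ‖f t‖ ≤ K)
    (hf0 : f 0 = 0) (hf'0 : derivWithin f (Ici 0) 0 = 0)
    (A B : H →L[ℂ] H) (hA : A ∈ τ.M1Infty) (hApos : 0 ≤ A) (hB : B ∈ N) :
    (∀ t : ℝ, 0 < t → opFun f ((t : ℂ) • A) * B ∈ τ.L1) ∧
      CesaroDomain (heatFun τ f A B) ∧
      cesaro (heatFun τ f A B) ∈ LInfty :=
  mainTheorem10_general τ hf.continuousOn (exists_norm_le_mul_min hf hbdd hf0 hf'0) hA hApos hB
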